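/- There is a deterministic leader election algorithm for the $\mathrm{KT}_1$ LOCAL model and an absolute constant $C$ such that the following holds. Let $G$ be a connected undirected graph with $n\ge 1$ nodes and diameter $D$, and let the nodes have arbitrary distinct identifiers (natural numbers). Initially each node knows only its own identifier and the set of identifiers of its neighbors (in particular, neither $n$ nor $D$ is known). All nodes run the algorithm in synchronous rounds, starting simultaneously; in each round a node may send to each of its neighbors one message of unrestricted size, and local computation is arbitrary. Then after at most $$C\,(D\log^2 n+\log^2 n)$$ rounds all nodes have terminated, and all of them output the identifier of one and the same node of $G$, the leader (so exactly one node is elected, and every node knows whether it is the leader). In total, over the whole execution, all nodes together send at most $$C\, n\log^2 n$$ messages. -/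

import Mathlib

/-- A deterministic distributed algorithm for the synchronous KT1 LOCAL model, in which every node
produces an output of type `Out`.  The same algorithm runs at every node of every network.

* `init i N` is the initial state of a node whose identifier is `i` and whose neighbors have exactly
  the identifiers in `N`; this is all that a node knows at the start.  In particular nothing is
  known about the size or the diameter of the network.
* `send s j` is the message (if any) that a node in state `s` sends in the current round to its
  neighbor with identifier `j`.
* `receive s inbox` is the next state of a node in state `s`, where `inbox j` is the message (if any)
  that it receives in the current round from its neighbor with identifier `j`.
* `output s = some o` says that `s` is a terminated state with output `o`; `output s = none` says
  that a node in state `s` is still running.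

Messages are elements of an arbitrary type: their size is not restricted.  Local computation is
arbitrary. -/
structure KT1LocalAlgorithm (Out : Type) where
  State : Type
  Msg : Type
  init : ℕ → Finset ℕ → State
  send : State → ℕ → Option Msg
  receive : State → (ℕ → Option Msg) → State
  output : State → Option Out

namespace KT1LocalAlgorithm

variable {Out : Type} (A : KT1LocalAlgorithm Out) {V : Type*} (G : SimpleGraph V) (ids : V ↪ ℕ)

open Classical in
/-- The message (if any) that travels from `w` to `v` in a round that starts in the global
configuration `s`.  Messages travel only along edges, and terminated nodes send nothing. -/
noncomputable def sent (s : V → A.State) (w v : V) : Option A.Msg :=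
  if G.Adj w v ∧ A.output (s w) = none then A.send (s w) (ids v) else none

/-- The messages that `v` receives in a round, indexed by the identifier of the sender. -/
noncomputable def inbox (s : V → A.State) (v : V) : ℕ → Option A.Msg :=
  Function.extend ids (fun w => A.sent G ids s w v) (fun _ => none)

/-- One synchronous round, performed simultaneously by all nodes.  Terminated nodes do not change
their state any more. -/
noncomputable def step (s : V → A.State) : V → A.State := fun v =>
  if A.output (s v) = none then A.receive (s v) (A.inbox G ids s v) else s v

variable [Fintype V]

open Classical in
/-- The initial global configuration. -/
noncomputable def start : V → A.State := fun v =>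
  A.init (ids v) ((Finset.univ.filter fun w => G.Adj v w).map ids)

/-- The global configuration after `t` rounds. -/
noncomputable def run (t : ℕ) : V → A.State :=
  (A.step G ids)^[t] (A.start G ids)

open Classical in
/-- The number of messages that all nodes together send in a round that starts in the global
configuration `s`. -/
noncomputable def messagesInRound (s : V → A.State) : ℕ :=
  (Finset.univ.filter fun p : V × V => A.sent G ids s p.1 p.2 ≠ none).card

/-- The total number of messages that all nodes send in the first `t` rounds. -/
noncomputable def messageCount (t : ℕ) : ℕ :=
  ∑ r ∈ Finset.range t, A.messagesInRound G ids (A.run G ids r)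

end KT1LocalAlgorithm

/-- After `t` rounds all nodes have terminated and have elected a unique leader `l`: every node
outputs the identifier of `l`.  Since identifiers are distinct, `l` is the only node that outputs its
own identifier (the elected node), and every other node knows that it is not elected. -/
def ElectsLeaderBy (A : KT1LocalAlgorithm ℕ) {V : Type*} [Fintype V] (G : SimpleGraph V)
    (ids : V ↪ ℕ) (t : ℕ) : Prop :=
  ∃ l : V, ∀ v : V, A.output (A.run G ids t v) = some (ids l)

/-!
The nodes first build a sparse spanner. In every iteration each node links to one neighbor that it
has not heard of yet; then rumors travel along the links of the current iteration down to those of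
the first one, and back. The nodes that a rumor of `x` reaches on its way down through `i`
iterations form a binomial tree of size `2 ^ i`, and the trees of two neighbors that have not heard
of each other are disjoint, so that after `log n` iterations every node has heard of all its
neighbors. Each iteration takes `O(log n)` rounds with at most `n` messages per round, adds at most
`n` links, and carries rumors over paths of `O(log n)` links, so the links form a spanner with
`O(n log n)` edges and stretch `O(log n)`.

The leader is elected on the spanner in phases. In each phase the remaining roots grow kingdoms,
which are trees, and a root goes on to the next phase only if it is the largest root at distance at
most two in the graph of kingdoms. A neighboring kingdom of a survivor thus loses, and the survivor
is the largest of all the neighbors of that kingdom, so the number of roots at least halves. All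
that a node has to say about a phase is a record of four entries, each written once. Sending the
records along the spanner edges whenever they change costs `O(n log n)` messages per phase, and a
phase takes `O(D log n)` rounds. The last root announces itself along the spanner.
-/

theorem mem_of_adj_of_support_subset {V : Type*} {G : SimpleGraph V} {U : Finset V}
    (hU : G.support ⊆ U) {x y : V} (h : G.Adj x y) : x ∈ U :=
  hU (G.mem_support.2 ⟨y, h⟩)

theorem edist_le_mul_length {V : Type*} {G H : SimpleGraph V} {s : ℕ}
    (h : ∀ u v, G.Adj u v → H.edist u v ≤ s) {u v : V} (p : G.Walk u v) :
    H.edist u v ≤ (s * p.length : ℕ) := by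
  induction p with
  | nil => simp
  | @cons u w v hadj p ih =>
    calc H.edist u v ≤ H.edist u w + H.edist w v := H.edist_triangle
      _ ≤ s + (s * p.length : ℕ) := add_le_add (h u w hadj) ih
      _ = (s * (SimpleGraph.Walk.cons hadj p).length : ℕ) := by
        rw [SimpleGraph.Walk.length_cons, mul_add_one, add_comm]; push_cast; rfl

theorem exists_walk_length_le_of_edist_le {V : Type*} {G : SimpleGraph V} {u v : V} {k : ℕ}
    (h : G.edist u v ≤ k) : ∃ p : G.Walk u v, p.length ≤ k := by
  obtain ⟨p, hp⟩ := SimpleGraph.exists_walk_of_edist_ne_top (h.trans_lt (ENat.natCast_lt_top k)).ne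
  exact ⟨p, by exact_mod_cast hp ▸ h⟩

theorem support_map_embedding {V W : Type*} (G : SimpleGraph V) (f : V ↪ W) :
    (G.map f).support = f '' G.support := by
  ext x
  constructor
  · rintro ⟨_, -, v, w, h, rfl, -⟩
    exact ⟨v, ⟨w, h⟩, rfl⟩
  · rintro ⟨v, ⟨w, h⟩, rfl⟩
    exact ⟨f w, SimpleGraph.map_adj_apply.2 h⟩

theorem edist_map_le_diam {V W : Type*} [Finite V] {G : SimpleGraph V} (hG : G.Connected)
    (f : V ↪ W) (v w : V) : (G.map f).edist (f v) (f w) ≤ G.diam := by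
  have := hG.nonempty
  obtain ⟨p, hp⟩ := hG.exists_walk_length_eq_dist v w
  have hdiam : G.dist v w ≤ G.diam :=
    SimpleGraph.dist_le_diam (SimpleGraph.connected_iff_ediam_ne_top.1 hG)
  calc (G.map f).edist (f v) (f w)
      ≤ (p.map (SimpleGraph.Embedding.map f G).toHom).length := SimpleGraph.edist_le _
    _ ≤ G.diam := by rw [SimpleGraph.Walk.length_map, hp]; exact_mod_cast hdiam

namespace KT1LocalAlgorithm

variable {Out : Type} (A : KT1LocalAlgorithm Out)

/-- The run of `A` on a network whose nodes are their own identifiers. -/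
noncomputable def idRun (H : SimpleGraph ℕ) [H.LocallyFinite] : ℕ → ℕ → A.State
  | 0 => fun x => A.init x (H.neighborFinset x)
  | t + 1 => A.step H (.refl ℕ) (idRun H t)

theorem inbox_refl (H : SimpleGraph ℕ) (s : ℕ → A.State) (x : ℕ) :
    A.inbox H (.refl ℕ) s x = fun y => A.sent H (.refl ℕ) s y x :=
  funext fun y => (Function.Embedding.refl ℕ).injective.extend_apply _ _ y

section relabel

variable {V : Type*} (G : SimpleGraph V) (ids : V ↪ ℕ)

theorem sent_map (s : ℕ → A.State) (w v : V) :
    A.sent (G.map ids) (.refl ℕ) s (ids w) (ids v) = A.sent G ids (s ∘ ids) w v := by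
  rw [sent, sent]
  congr 2
  exact propext SimpleGraph.map_adj_apply

theorem inbox_map (s : ℕ → A.State) (v : V) :
    A.inbox (G.map ids) (.refl ℕ) s (ids v) = A.inbox G ids (s ∘ ids) v := by
  rw [inbox_refl]
  funext y
  by_cases hy : ∃ w, ids w = y
  · obtain ⟨w, rfl⟩ := hy
    rw [sent_map, inbox, ids.injective.extend_apply]
  · have hadj : ¬ (G.map ids).Adj y (ids v) := by
      rintro ⟨-, w, -, -, hw, -⟩
      exact hy ⟨w, hw⟩
    rw [inbox, Function.extend_apply' _ _ _ hy, sent, if_neg (fun h => hadj h.1)]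

theorem step_map (s : ℕ → A.State) :
    A.step (G.map ids) (.refl ℕ) s ∘ ids = A.step G ids (s ∘ ids) := by
  funext v
  simp only [step, Function.comp_apply, inbox_map]

variable [Fintype V] [(G.map ids).LocallyFinite]

theorem run_eq_idRun_map (t : ℕ) : A.run G ids t = A.idRun (G.map ids) t ∘ ids := by
  induction t with
  | zero =>
    funext v
    simp only [run, Function.iterate_zero, id, start, idRun, Function.comp_apply]
    congr 1
    ext x
    simp
  | succ t ih => rw [run, Function.iterate_succ_apply', ← run, ih, idRun, step_map]

open Classical in
theorem messagesInRound_run (t : ℕ) :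
    A.messagesInRound G ids (A.run G ids t) =
      ((Finset.univ.map ids ×ˢ Finset.univ.map ids).filter fun p : ℕ × ℕ =>
        A.sent (G.map ids) (.refl ℕ) (A.idRun (G.map ids) t) p.1 p.2 ≠ none).card := by
  rw [← Finset.prodMap_map_product, Finset.filter_map, Finset.card_map, run_eq_idRun_map,
    messagesInRound, Finset.univ_product_univ]
  simp only [Function.comp_def, Function.Embedding.coe_prodMap, Prod.map, sent_map]

end relabel

end KT1LocalAlgorithm

/-- The least element of `s`, as the choice rule of the nodes; `none` if `s` is empty. -/
def leastId (s : Finset ℕ) : Option ℕ := s.sort.head?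

theorem mem_of_leastId_eq_some {s : Finset ℕ} {x : ℕ} (h : leastId s = some x) : x ∈ s :=
  (Finset.mem_sort _).1 (List.mem_of_head? h)

theorem exists_leastId_eq_some {s : Finset ℕ} (h : s.Nonempty) : ∃ x, leastId s = some x :=
  Option.ne_none_iff_exists'.1 <| by
    simpa [leastId, ← List.length_eq_zero_iff, Finset.nonempty_iff_ne_empty] using h

/-- The state of a node during the construction of the spanner.  In iteration `iter` the neighbors
that the node has not yet heard of are `unknown`; `out j` is the link that it chose in iteration
`j`, and `inn j` are the neighbors that chose it in iteration `j`.  An iteration has `2 * iter + 2`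
rounds, the current one being `round`, in which the `rumors` travel first along the links of the
iterations `iter, …, 0` and then backwards along the links of the iterations `0, …, iter`. -/
structure SpannerState where
  id : ℕ
  iter : ℕ
  round : ℕ
  nbrs : Finset ℕ
  unknown : Finset ℕ
  out : ℕ → Option ℕ
  inn : ℕ → Finset ℕ
  rumors : Finset ℕ

namespace SpannerState

/-- The initial state of the node `x` with neighbors `N`. -/
def init (x : ℕ) (N : Finset ℕ) : SpannerState where
  id := x
  iter := 0
  round := 0
  nbrs := N
  unknown := N
  out := fun j => if j = 0 then leastId N else none
  inn := fun _ => ∅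
  rumors := if N = ∅ then ∅ else {x}

/-- The set of rumors that is sent to `y`. -/
def send (s : SpannerState) (y : ℕ) : Option (Finset ℕ) :=
  if s.rumors.Nonempty ∧ (s.round ≤ s.iter ∧ s.out (s.iter - s.round) = some y ∨
      s.iter < s.round ∧ y ∈ s.inn (s.round - s.iter - 1)) then
    some s.rumors
  else none

/-- The rumors known at the end of the current round. -/
def mergedRumors (s : SpannerState) (inbox : ℕ → Option (Finset ℕ)) : Finset ℕ :=
  s.rumors ∪ s.nbrs.biUnion fun y => (inbox y).getD ∅

/-- The value of `inn` at the end of the current round.  The senders in the first round of an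
iteration are the nodes whose new link is the receiver. -/
def updatedInn (s : SpannerState) (inbox : ℕ → Option (Finset ℕ)) (j : ℕ) : Finset ℕ :=
  if s.round = 0 ∧ j = s.iter then s.nbrs.filter fun y => inbox y ≠ none else s.inn j

/-- The transition of a node.  At the end of an iteration, the node removes what it has heard of
from `unknown`, and takes part in the next iteration with a fresh rumor if something is left. -/
def receive (s : SpannerState) (inbox : ℕ → Option (Finset ℕ)) : SpannerState :=
  if s.round = 2 * s.iter + 1 then
    { s with
      iter := s.iter + 1
      round := 0
      unknown := s.unknown \ s.mergedRumors inbox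
      out := fun j =>
        if j = s.iter + 1 then leastId (s.unknown \ s.mergedRumors inbox) else s.out j
      inn := s.updatedInn inbox
      rumors := if s.unknown \ s.mergedRumors inbox = ∅ then ∅ else {s.id} }
  else
    { s with
      round := s.round + 1
      inn := s.updatedInn inbox
      rumors := s.mergedRumors inbox }

open Classical in
/-- The spanner edges at a node that are known to it so far. -/
noncomputable def links (s : SpannerState) : Finset ℕ :=
  s.nbrs.filter fun y => ∃ j, s.out j = some y ∨ y ∈ s.inn j

theorem mem_mergedRumors {s : SpannerState} {inbox : ℕ → Option (Finset ℕ)} {v : ℕ} :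
    v ∈ s.mergedRumors inbox ↔ v ∈ s.rumors ∨ ∃ y ∈ s.nbrs, ∃ R, inbox y = some R ∧ v ∈ R := by
  have hgetD (o : Option (Finset ℕ)) : v ∈ o.getD ∅ ↔ ∃ R, o = some R ∧ v ∈ R := by
    cases o <;> simp
  simp only [mergedRumors, Finset.mem_union, Finset.mem_biUnion, hgetD]

theorem unknown_receive_subset (s : SpannerState) (inbox : ℕ → Option (Finset ℕ)) :
    (s.receive inbox).unknown ⊆ s.unknown := by
  unfold receive
  split_ifs
  exacts [Finset.sdiff_subset, Finset.sdiff_subset, Finset.Subset.refl _]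

end SpannerState

/-- The first round of iteration `i` of the spanner construction. -/
def iterStart (i : ℕ) : ℕ := i * (i + 1)

theorem iterStart_succ (i : ℕ) : iterStart (i + 1) = iterStart i + (2 * i + 1) + 1 := by
  unfold iterStart; ring

theorem iterStart_mono : Monotone iterStart := fun i j (h : i ≤ j) =>
  Nat.mul_le_mul h (Nat.succ_le_succ h)

theorem exists_eq_iterStart_add (t : ℕ) : ∃ i k, k ≤ 2 * i + 1 ∧ t = iterStart i + k := by
  induction t with
  | zero => exact ⟨0, 0, by omega, rfl⟩
  | succ t ih =>
    obtain ⟨i, k, hk, rfl⟩ := ih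
    rcases hk.lt_or_eq with h | rfl
    · exact ⟨i, k + 1, by omega, rfl⟩
    · exact ⟨i + 1, 0, by omega, by rw [iterStart_succ]⟩

theorem le_of_iterStart_le {i j k : ℕ} (hk : k ≤ 2 * i + 1)
    (h : iterStart j ≤ iterStart i + k) : j ≤ i := by
  by_contra! hij
  have := iterStart_mono (Nat.succ_le_of_lt hij)
  rw [Nat.succ_eq_add_one, iterStart_succ] at this
  omega

section spanner

variable (H : SimpleGraph ℕ) [H.LocallyFinite]

/-- The messages that `x` receives in the configuration `s`, indexed by their senders. -/
def spannerInbox (s : ℕ → SpannerState) (x y : ℕ) : Option (Finset ℕ) :=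
  if y ∈ H.neighborFinset x then (s y).send x else none

/-- The configuration of the spanner construction on `H` after `t` rounds. -/
def spannerRun : ℕ → ℕ → SpannerState
  | 0, x => SpannerState.init x (H.neighborFinset x)
  | t + 1, x => (spannerRun t x).receive (spannerInbox H (spannerRun t) x)

/-- The neighbors that are unknown to `x` at the start of iteration `i`. -/
def unknownNbrs (i x : ℕ) : Finset ℕ := (spannerRun H (iterStart i) x).unknown

/-- The link that `x` chooses in iteration `i`. -/
def link (i x : ℕ) : Option ℕ := leastId (unknownNbrs H i x)

/-- In round `k` of iteration `i` the node `x` forwards its rumors to `y`. -/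
def Forwards (i k x y : ℕ) : Prop :=
  k ≤ i ∧ link H (i - k) x = some y ∨ i < k ∧ link H (k - i - 1) y = some x

/-- The rumors that `x` knows at the end of round `t`, before a new iteration resets them. -/
def rumorsAfter (t x : ℕ) : Finset ℕ :=
  (spannerRun H t x).mergedRumors (spannerInbox H (spannerRun H t) x)

/-- The binomial tree of order `j` that hangs on `x`: it consists of the tree of order `j - 1` that
hangs on `x` and the one that hangs on the link of `x` in iteration `j - 1`. -/
def binomialTree : ℕ → ℕ → Finset ℕ
  | 0, x => {x}
  | j + 1, x => binomialTree j x ∪ (link H j x).elim ∅ (binomialTree j)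

/-- The form of the state `s` of the node `x` in round `k` of iteration `i`. -/
structure SpannerInvariant (i k x : ℕ) (s : SpannerState) : Prop where
  id : s.id = x
  iter : s.iter = i
  round : s.round = k
  nbrs : s.nbrs = H.neighborFinset x
  unknown : s.unknown = unknownNbrs H i x
  out : ∀ j, s.out j = if j ≤ i then link H j x else none
  mem_inn : ∀ j y, y ∈ s.inn j ↔ link H j y = some x ∧ (j < i ∨ j = i ∧ 0 < k)
  rumors : k = 0 → s.rumors = if unknownNbrs H i x = ∅ then ∅ else {x}

variable {H}

theorem id_spannerRun (t x : ℕ) : (spannerRun H t x).id = x := by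
  induction t with
  | zero => rfl
  | succ t ih =>
    rw [spannerRun, SpannerState.receive]
    split_ifs <;> exact ih

theorem unknown_spannerRun_antitone (x : ℕ) : Antitone fun t => (spannerRun H t x).unknown :=
  antitone_nat_of_succ_le fun _ => SpannerState.unknown_receive_subset _ _

theorem unknownNbrs_antitone (x : ℕ) : Antitone fun i => unknownNbrs H i x :=
  (unknown_spannerRun_antitone x).comp_monotone iterStart_mono

theorem unknown_spannerRun_eq_empty_of_le {s t x : ℕ} (hst : s ≤ t)
    (h : (spannerRun H s x).unknown = ∅) : (spannerRun H t x).unknown = ∅ :=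
  Finset.subset_empty.1 (h ▸ unknown_spannerRun_antitone x hst)

theorem adj_of_mem_unknownNbrs {i x y : ℕ} (h : y ∈ unknownNbrs H i x) : H.Adj x y :=
  (H.mem_neighborFinset x y).1 (unknownNbrs_antitone x (Nat.zero_le i) h)

theorem mem_unknownNbrs_of_link {i x y : ℕ} (h : link H i x = some y) : y ∈ unknownNbrs H i x :=
  mem_of_leastId_eq_some h

theorem adj_of_link {i x y : ℕ} (h : link H i x = some y) : H.Adj x y :=
  adj_of_mem_unknownNbrs (mem_unknownNbrs_of_link h)

theorem Forwards.adj {i k x y : ℕ} (h : Forwards H i k x y) : H.Adj x y := by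
  obtain ⟨-, h⟩ | ⟨-, h⟩ := h
  exacts [adj_of_link h, (adj_of_link h).symm]

theorem SpannerInvariant.round_eq_last_iff {i k x : ℕ} {s : SpannerState}
    (h : SpannerInvariant H i k x s) : s.round = 2 * s.iter + 1 ↔ k = 2 * i + 1 := by
  rw [h.iter, h.round]

theorem SpannerInvariant.send_eq_some_iff {i k x : ℕ} {s : SpannerState}
    (h : SpannerInvariant H i k x s) (hk : k ≤ 2 * i + 1) {y : ℕ} {R : Finset ℕ} :
    s.send y = some R ↔ Forwards H i k x y ∧ s.rumors.Nonempty ∧ s.rumors = R := by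
  have hinn : i < k → (k - i - 1 < i ∨ k - i - 1 = i ∧ 0 < k) := by omega
  simp only [SpannerState.send, Forwards, h.iter, h.round, h.out, h.mem_inn, Nat.sub_le, if_true,
    Option.ite_none_right_eq_some, Option.some.injEq]
  tauto

theorem spannerInbox_eq_some_iff {i k : ℕ} {s : ℕ → SpannerState}
    (h : ∀ x, SpannerInvariant H i k x (s x)) (hk : k ≤ 2 * i + 1) {x y : ℕ} {R : Finset ℕ} :
    spannerInbox H s x y = some R ↔
      Forwards H i k y x ∧ (s y).rumors.Nonempty ∧ (s y).rumors = R := by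
  simp only [spannerInbox, Option.ite_none_right_eq_some, (h y).send_eq_some_iff hk,
    SimpleGraph.mem_neighborFinset]
  exact and_iff_right_of_imp fun h => h.1.adj.symm

theorem spannerInbox_ne_none_iff {i : ℕ} {s : ℕ → SpannerState}
    (h : ∀ x, SpannerInvariant H i 0 x (s x)) {x y : ℕ} :
    spannerInbox H s x y ≠ none ↔ link H i y = some x := by
  have hrumors : link H i y = some x → (s y).rumors.Nonempty := by
    intro hlink
    rw [(h y).rumors rfl, if_neg (Finset.ne_empty_of_mem (mem_unknownNbrs_of_link hlink))]
    exact Finset.singleton_nonempty y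
  simp only [Option.ne_none_iff_exists', spannerInbox_eq_some_iff h (Nat.zero_le _), Forwards,
    Nat.zero_le, Nat.sub_zero, true_and, Nat.not_lt_zero, false_and, or_false, exists_and_left,
    exists_eq', and_true]
  exact and_iff_left_of_imp hrumors

theorem mem_updatedInn_iff {i k : ℕ} {s : ℕ → SpannerState}
    (h : ∀ x, SpannerInvariant H i k x (s x)) {j x y : ℕ} :
    y ∈ (s x).updatedInn (spannerInbox H s x) j ↔ link H j y = some x ∧ j ≤ i := by
  simp only [SpannerState.updatedInn, (h x).iter, (h x).round, (h x).nbrs]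
  split_ifs with hj
  · obtain ⟨rfl, rfl⟩ := hj
    rw [Finset.mem_filter, spannerInbox_ne_none_iff h, SimpleGraph.mem_neighborFinset,
      and_iff_left le_rfl]
    exact and_iff_right_of_imp fun hlink => (adj_of_link hlink).symm
  · rw [(h x).mem_inn]
    exact and_congr_right' (by omega)

theorem spannerInvariant_init (x : ℕ) : SpannerInvariant H 0 0 x (spannerRun H 0 x) where
  id := rfl
  iter := rfl
  round := rfl
  nbrs := rfl
  unknown := rfl
  out j := by
    change (if j = 0 then leastId (unknownNbrs H 0 x) else none) = _
    simp only [Nat.le_zero]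
    split_ifs with hj
    exacts [hj ▸ rfl, rfl]
  mem_inn j y := by
    change y ∈ (∅ : Finset ℕ) ↔ _
    simp
  rumors _ := rfl

theorem spannerInvariant_succ_round {i k : ℕ} (hk : k < 2 * i + 1)
    (h : ∀ x, SpannerInvariant H i k x (spannerRun H (iterStart i + k) x)) (x : ℕ) :
    SpannerInvariant H i (k + 1) x (spannerRun H (iterStart i + (k + 1)) x) := by
  have hx := h x
  have hlast := mt hx.round_eq_last_iff.1 hk.ne
  rw [← add_assoc, spannerRun, SpannerState.receive, if_neg hlast]
  refine ⟨hx.id, hx.iter, congrArg (· + 1) hx.round, hx.nbrs, hx.unknown, hx.out, fun j y => ?_,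
    fun hk => absurd hk k.succ_ne_zero⟩
  exact (mem_updatedInn_iff h).trans (and_congr_right' (by omega))

theorem spannerInvariant_succ_iter {i : ℕ}
    (h : ∀ x, SpannerInvariant H i (2 * i + 1) x (spannerRun H (iterStart i + (2 * i + 1)) x))
    (x : ℕ) : SpannerInvariant H (i + 1) 0 x (spannerRun H (iterStart (i + 1)) x) := by
  set s := spannerRun H (iterStart i + (2 * i + 1))
  have hx := h x
  have hlast := hx.round_eq_last_iff.2 rfl
  have hrun : spannerRun H (iterStart (i + 1)) x = (s x).receive (spannerInbox H s x) := by
    rw [iterStart_succ, spannerRun]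
  have hunknown : unknownNbrs H (i + 1) x =
      (s x).unknown \ (s x).mergedRumors (spannerInbox H s x) := by
    rw [unknownNbrs, hrun, SpannerState.receive, if_pos hlast]
  rw [hrun, SpannerState.receive, if_pos hlast, ← hunknown]
  refine ⟨hx.id, congrArg (· + 1) hx.iter, rfl, hx.nbrs, rfl, fun j => ?_, fun j y => ?_,
    fun _ => by simp only [hx.id]⟩
  · simp only [hx.iter, hx.out]
    by_cases hj : j = i + 1
    · rw [if_pos hj, if_pos hj.le, hj, link]
    · rw [if_neg hj]
      exact if_congr (by omega) rfl rfl
  · exact (mem_updatedInn_iff h).trans (and_congr_right' (by omega))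

theorem spannerInvariant_spannerRun {i : ℕ} :
    ∀ {k : ℕ}, k ≤ 2 * i + 1 →
      ∀ x, SpannerInvariant H i k x (spannerRun H (iterStart i + k) x) := by
  have rounds {i : ℕ} (h : ∀ x, SpannerInvariant H i 0 x (spannerRun H (iterStart i) x)) :
      ∀ {k : ℕ}, k ≤ 2 * i + 1 →
        ∀ x, SpannerInvariant H i k x (spannerRun H (iterStart i + k) x) := by
    intro k hk
    induction k with
    | zero => exact h
    | succ k ih => exact spannerInvariant_succ_round (by omega) (ih (by omega))
  induction i with
  | zero => exact rounds spannerInvariant_init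
  | succ i ih => exact rounds (spannerInvariant_succ_iter (ih le_rfl))

theorem rumors_spannerRun_succ {i k : ℕ} (hk : k < 2 * i + 1) (x : ℕ) :
    (spannerRun H (iterStart i + (k + 1)) x).rumors = rumorsAfter H (iterStart i + k) x := by
  have hlast :=
    mt (spannerInvariant_spannerRun (H := H) hk.le x).round_eq_last_iff.1 hk.ne
  rw [← add_assoc, spannerRun, SpannerState.receive, if_neg hlast, rumorsAfter]

theorem unknownNbrs_succ (i x : ℕ) : unknownNbrs H (i + 1) x =
    unknownNbrs H i x \ rumorsAfter H (iterStart i + (2 * i + 1)) x := by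
  have hx := spannerInvariant_spannerRun (H := H) (le_refl (2 * i + 1)) x
  rw [← hx.unknown, unknownNbrs, iterStart_succ, spannerRun, SpannerState.receive,
    if_pos (hx.round_eq_last_iff.2 rfl), rumorsAfter]

theorem mem_rumorsAfter {i k : ℕ} (hk : k ≤ 2 * i + 1) {x v : ℕ} :
    v ∈ rumorsAfter H (iterStart i + k) x ↔ v ∈ (spannerRun H (iterStart i + k) x).rumors ∨
      ∃ y, v ∈ (spannerRun H (iterStart i + k) y).rumors ∧ Forwards H i k y x := by
  have h := spannerInvariant_spannerRun (H := H) hk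
  simp only [rumorsAfter, SpannerState.mem_mergedRumors, spannerInbox_eq_some_iff h hk, (h x).nbrs,
    SimpleGraph.mem_neighborFinset]
  refine or_congr_right (exists_congr fun y => ⟨?_, ?_⟩)
  · rintro ⟨-, _, ⟨hfwd, -, rfl⟩, hv⟩
    exact ⟨hv, hfwd⟩
  · rintro ⟨hv, hfwd⟩
    exact ⟨hfwd.adj.symm, _, ⟨hfwd, ⟨v, hv⟩, rfl⟩, hv⟩

theorem mem_binomialTree_succ {j x w : ℕ} : w ∈ binomialTree H (j + 1) x ↔
    w ∈ binomialTree H j x ∨ ∃ u, link H j x = some u ∧ w ∈ binomialTree H j u := by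
  rw [binomialTree, Finset.mem_union]
  cases link H j x <;> simp

theorem mem_rumors_iterStart {i v x : ℕ} :
    v ∈ (spannerRun H (iterStart i) x).rumors ↔ v = x ∧ unknownNbrs H i v ≠ ∅ := by
  have hrumors := (spannerInvariant_spannerRun (H := H) (Nat.zero_le (2 * i + 1)) x).rumors rfl
  rw [add_zero] at hrumors
  rw [hrumors]
  split_ifs with hx
  · simp only [Finset.notMem_empty, false_iff, not_and, not_not]
    rintro rfl
    exact hx
  · rw [Finset.mem_singleton]
    exact (and_iff_left_of_imp fun hv => hv ▸ hx).symm

/- In the first half of iteration `i` the links are used from the latest to the earliest, so the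
nodes that know the rumor of `v` after `k` rounds are the roots of the subtrees of order `i + 1 - k`
into which the tree of `v` splits. -/
theorem exists_rumors_mem_binomialTree_iff {i k : ℕ} (hk : k ≤ i + 1) {v w : ℕ} :
    (∃ z, v ∈ (spannerRun H (iterStart i + k) z).rumors ∧ w ∈ binomialTree H (i + 1 - k) z) ↔
      unknownNbrs H i v ≠ ∅ ∧ w ∈ binomialTree H (i + 1) v := by
  induction k with
  | zero =>
    simp only [add_zero, mem_rumors_iterStart, Nat.sub_zero, and_assoc, exists_eq_left']
  | succ k ih =>
    rw [← ih (by omega)]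
    have hsub : i + 1 - k = (i - k) + 1 := by omega
    have hsub' : i + 1 - (k + 1) = i - k := by omega
    have hki : k ≤ i := by omega
    simp only [rumors_spannerRun_succ (H := H) (i := i) (k := k) (by omega),
      mem_rumorsAfter (i := i) (k := k) (by omega), Forwards, hsub, hsub', mem_binomialTree_succ,
      hki.not_gt, hki, false_and, or_false, true_and]
    constructor
    · rintro ⟨z, hz | ⟨y, hy, hlink⟩, hw⟩
      exacts [⟨z, hz, Or.inl hw⟩, ⟨y, hy, Or.inr ⟨z, hlink, hw⟩⟩]
    · rintro ⟨z, hz, hw | ⟨u, hlink, hw⟩⟩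
      exacts [⟨z, Or.inl hz, hw⟩, ⟨u, Or.inr ⟨z, hz, hlink⟩, hw⟩]

theorem mem_rumors_push_iff {i v w : ℕ} :
    v ∈ (spannerRun H (iterStart i + (i + 1)) w).rumors ↔
      unknownNbrs H i v ≠ ∅ ∧ w ∈ binomialTree H (i + 1) v := by
  rw [← exists_rumors_mem_binomialTree_iff le_rfl, Nat.sub_self]
  simp [binomialTree]

theorem mem_rumors_pull_iff {i j : ℕ} (hj : j ≤ i) {v x : ℕ} :
    v ∈ (spannerRun H (iterStart i + (i + 1 + j)) x).rumors ↔
      ∃ w ∈ binomialTree H j x, unknownNbrs H i v ≠ ∅ ∧ w ∈ binomialTree H (i + 1) v := by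
  induction j generalizing x with
  | zero => simp [binomialTree, mem_rumors_push_iff]
  | succ j ih =>
    have hi : i < i + 1 + j := by omega
    have hsub : i + 1 + j - i - 1 = j := by omega
    rw [← add_assoc (i + 1) j 1, rumors_spannerRun_succ (by omega), mem_rumorsAfter (by omega)]
    simp only [Forwards, hi, hi.not_ge, hsub, false_and, false_or, true_and, ih (by omega),
      mem_binomialTree_succ]
    constructor
    · rintro (⟨w, hw, hv⟩ | ⟨y, ⟨w, hw, hv⟩, hlink⟩)
      exacts [⟨w, Or.inl hw, hv⟩, ⟨w, Or.inr ⟨y, hlink, hw⟩, hv⟩]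
    · rintro ⟨w, hw | ⟨y, hlink, hw⟩, hv⟩
      exacts [Or.inl ⟨w, hw, hv⟩, Or.inr ⟨y, ⟨w, hw, hv⟩, hlink⟩]

theorem mem_rumorsAfter_last_iff {i v x : ℕ} :
    v ∈ rumorsAfter H (iterStart i + (2 * i + 1)) x ↔ unknownNbrs H i v ≠ ∅ ∧
      ∃ w, w ∈ binomialTree H (i + 1) v ∧ w ∈ binomialTree H (i + 1) x := by
  have hround : 2 * i + 1 = i + 1 + i := by ring
  have hi : i < i + 1 + i := by omega
  have hsub : i + 1 + i - i - 1 = i := by omega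
  rw [mem_rumorsAfter le_rfl, hround]
  simp only [Forwards, hi, hi.not_ge, hsub, false_and, false_or, true_and,
    mem_rumors_pull_iff le_rfl, mem_binomialTree_succ (x := x)]
  constructor
  · rintro (⟨w, hw, hv, hv'⟩ | ⟨y, ⟨w, hw, hv, hv'⟩, hlink⟩)
    exacts [⟨hv, w, hv', Or.inl hw⟩, ⟨hv, w, hv', Or.inr ⟨y, hlink, hw⟩⟩]
  · rintro ⟨hv, w, hv', hw | ⟨y, hlink, hw⟩⟩
    exacts [Or.inl ⟨w, hw, hv, hv'⟩, Or.inr ⟨y, ⟨w, hw, hv, hv'⟩, hlink⟩]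

theorem mem_unknownNbrs_symm {i x y : ℕ} (h : y ∈ unknownNbrs H i x) :
    x ∈ unknownNbrs H i y := by
  induction i generalizing x y with
  | zero => exact (H.mem_neighborFinset y x).2 (adj_of_mem_unknownNbrs h).symm
  | succ i ih =>
    rw [unknownNbrs_succ, Finset.mem_sdiff, mem_rumorsAfter_last_iff] at h ⊢
    refine ⟨ih h.1, ?_⟩
    rintro ⟨-, w, hx, hy⟩
    exact h.2 ⟨Finset.ne_empty_of_mem (ih h.1), w, hy, hx⟩

theorem disjoint_binomialTree {i x y : ℕ} (h : y ∈ unknownNbrs H i x) :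
    Disjoint (binomialTree H i x) (binomialTree H i y) := by
  cases i with
  | zero => exact Finset.disjoint_singleton.2 (adj_of_mem_unknownNbrs h).ne
  | succ i =>
    rw [unknownNbrs_succ, Finset.mem_sdiff, mem_rumorsAfter_last_iff] at h
    rw [Finset.disjoint_left]
    intro w hx hy
    exact h.2 ⟨Finset.ne_empty_of_mem (mem_unknownNbrs_symm h.1), w, hy, hx⟩

theorem card_binomialTree_succ {i x : ℕ} (h : unknownNbrs H i x ≠ ∅) :
    (binomialTree H (i + 1) x).card = 2 ^ (i + 1) := by
  have card_of_unknown : ∀ y, unknownNbrs H i y ≠ ∅ → (binomialTree H i y).card = 2 ^ i := by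
    cases i with
    | zero => intro y _; rfl
    | succ i =>
      intro y hy
      refine card_binomialTree_succ fun hempty => hy ?_
      exact Finset.subset_empty.1 (hempty ▸ unknownNbrs_antitone y i.le_succ)
  obtain ⟨y, hlink⟩ := exists_leastId_eq_some (Finset.nonempty_iff_ne_empty.2 h)
  have hy : y ∈ unknownNbrs H i x := mem_unknownNbrs_of_link hlink
  have hsplit : binomialTree H (i + 1) x = binomialTree H i x ∪ binomialTree H i y := by
    rw [binomialTree, link, hlink, Option.elim_some]
  rw [hsplit, Finset.card_union_of_disjoint (disjoint_binomialTree hy), card_of_unknown x h,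
    card_of_unknown y (Finset.ne_empty_of_mem (mem_unknownNbrs_symm hy)), pow_succ, mul_two]

variable {U : Finset ℕ}

theorem binomialTree_subset (hU : H.support ⊆ U) {i x : ℕ} (hx : x ∈ U) :
    binomialTree H i x ⊆ U := by
  induction i generalizing x with
  | zero => exact Finset.singleton_subset_iff.2 hx
  | succ i ih =>
    intro w hw
    obtain hw | ⟨y, hlink, hw⟩ := mem_binomialTree_succ.1 hw
    exacts [ih hx hw, ih (mem_of_adj_of_support_subset hU (adj_of_link hlink).symm) hw]

theorem unknownNbrs_eq_empty (hU : H.support ⊆ U) {i x : ℕ} (hi : Nat.log 2 U.card ≤ i) :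
    unknownNbrs H i x = ∅ := by
  by_contra h
  obtain ⟨y, hy⟩ := Finset.nonempty_iff_ne_empty.2 h
  have hx : x ∈ U := mem_of_adj_of_support_subset hU (adj_of_mem_unknownNbrs hy)
  have hcard := Finset.card_le_card (binomialTree_subset hU (i := i + 1) hx)
  rw [card_binomialTree_succ h] at hcard
  have := Nat.le_log_of_pow_le one_lt_two hcard
  omega

theorem unknown_spannerRun_eq_empty (hU : H.support ⊆ U) {t x : ℕ}
    (ht : iterStart (Nat.log 2 U.card) ≤ t) : (spannerRun H t x).unknown = ∅ :=
  unknown_spannerRun_eq_empty_of_le ht (unknownNbrs_eq_empty hU le_rfl)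

theorem link_lt (hU : H.support ⊆ U) {i x y : ℕ} (h : link H i x = some y) :
    i < Nat.log 2 U.card := by
  by_contra! hi
  exact Finset.ne_empty_of_mem (mem_unknownNbrs_of_link h) (unknownNbrs_eq_empty hU hi)

variable (H) in
/-- The spanner: two nodes are adjacent if one of them chooses the other as a link. -/
def spanner : SimpleGraph ℕ where
  Adj x y := ∃ j, link H j x = some y ∨ link H j y = some x
  symm := ⟨fun _ _ ⟨j, h⟩ => ⟨j, h.symm⟩⟩
  loopless := ⟨fun _ ⟨_, h⟩ => H.irrefl (adj_of_link (or_self_iff.1 h))⟩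

theorem spanner_le : spanner H ≤ H := by
  rintro x y ⟨j, h | h⟩
  exacts [adj_of_link h, (adj_of_link h).symm]

noncomputable instance : (spanner H).LocallyFinite := fun x =>
  ((H.neighborFinset x).finite_toSet.subset fun _ h =>
    (H.mem_neighborFinset x _).2 (spanner_le h)).fintype

theorem spanner_adj_of_link {j x y : ℕ} (h : link H j x = some y) : (spanner H).Adj x y :=
  ⟨j, Or.inl h⟩

theorem Forwards.spanner_adj {i k x y : ℕ} (h : Forwards H i k x y) : (spanner H).Adj x y := by
  obtain ⟨-, h⟩ | ⟨-, h⟩ := h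
  exacts [spanner_adj_of_link h, (spanner_adj_of_link h).symm]

theorem support_spanner_subset (hU : H.support ⊆ U) : (spanner H).support ⊆ U :=
  (SimpleGraph.support_mono spanner_le).trans hU

theorem mem_links_iff {i k : ℕ} (hk : k ≤ 2 * i + 1) {x y : ℕ} :
    y ∈ (spannerRun H (iterStart i + k) x).links ↔
      ∃ j, j ≤ i ∧ link H j x = some y ∨ link H j y = some x ∧ (j < i ∨ j = i ∧ 0 < k) := by
  have h := spannerInvariant_spannerRun (H := H) hk x
  simp only [SpannerState.links, Finset.mem_filter, h.nbrs, h.mem_inn, h.out,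
    Option.ite_none_right_eq_some, SimpleGraph.mem_neighborFinset]
  refine and_iff_right_of_imp ?_
  rintro ⟨j, ⟨-, h⟩ | ⟨h, -⟩⟩
  exacts [adj_of_link h, (adj_of_link h).symm]

theorem links_subset_neighborFinset_spanner (t x : ℕ) :
    (spannerRun H t x).links ⊆ (spanner H).neighborFinset x := fun y hy => by
  obtain ⟨i, k, hk, rfl⟩ := exists_eq_iterStart_add t
  obtain ⟨j, hj⟩ := (mem_links_iff hk).1 hy
  exact ((spanner H).mem_neighborFinset x y).2 ⟨j, hj.imp And.right And.left⟩

theorem links_eq_neighborFinset_spanner {t x : ℕ} (h : (spannerRun H t x).unknown = ∅) :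
    (spannerRun H t x).links = (spanner H).neighborFinset x := by
  obtain ⟨i, k, hk, rfl⟩ := exists_eq_iterStart_add t
  have lt_of_unknown {j y : ℕ} (hy : y ∈ unknownNbrs H j x) : j < i := by
    by_contra! hij
    rw [(spannerInvariant_spannerRun hk x).unknown] at h
    exact Finset.notMem_empty y (h ▸ unknownNbrs_antitone x hij hy)
  ext y
  rw [mem_links_iff hk, SimpleGraph.mem_neighborFinset]
  constructor
  · rintro ⟨j, ⟨-, h⟩ | ⟨h, -⟩⟩
    exacts [⟨j, Or.inl h⟩, ⟨j, Or.inr h⟩]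
  · rintro ⟨j, h | h⟩
    · exact ⟨j, Or.inl ⟨(lt_of_unknown (mem_unknownNbrs_of_link h)).le, h⟩⟩
    · have hx := mem_unknownNbrs_symm (mem_unknownNbrs_of_link h)
      exact ⟨j, Or.inr ⟨h, Or.inl (lt_of_unknown hx)⟩⟩

theorem edist_spanner_le_of_mem_binomialTree {j x w : ℕ} (h : w ∈ binomialTree H j x) :
    (spanner H).edist x w ≤ j := by
  induction j generalizing x with
  | zero => simp [Finset.mem_singleton.1 h]
  | succ j ih =>
    obtain hw | ⟨y, hlink, hw⟩ := mem_binomialTree_succ.1 h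
    · exact (ih hw).trans (Nat.cast_le.2 j.le_succ)
    · calc (spanner H).edist x w
          ≤ (spanner H).edist x y + (spanner H).edist y w := SimpleGraph.edist_triangle
        _ ≤ 1 + j := add_le_add
            (SimpleGraph.edist_eq_one_iff_adj.2 (spanner_adj_of_link hlink)).le (ih hw)
        _ = (j + 1 : ℕ) := by rw [add_comm]; rfl

theorem edist_spanner_le_or_mem_unknownNbrs {x y : ℕ} (h : H.Adj x y) (i : ℕ) :
    (spanner H).edist x y ≤ (2 * i : ℕ) ∨ y ∈ unknownNbrs H i x := by
  induction i with
  | zero => exact Or.inr ((H.mem_neighborFinset x y).2 h)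
  | succ i ih =>
    obtain ih | ih := ih
    · exact Or.inl (ih.trans (Nat.cast_le.2 (by omega)))
    refine or_iff_not_imp_right.2 fun hknown => ?_
    rw [unknownNbrs_succ, Finset.mem_sdiff, mem_rumorsAfter_last_iff, not_and, not_not] at hknown
    obtain ⟨-, w, hy, hx⟩ := hknown ih
    calc (spanner H).edist x y
        ≤ (spanner H).edist x w + (spanner H).edist w y := SimpleGraph.edist_triangle
      _ ≤ (i + 1 : ℕ) + (i + 1 : ℕ) := add_le_add (edist_spanner_le_of_mem_binomialTree hx)
          (SimpleGraph.edist_comm.trans_le (edist_spanner_le_of_mem_binomialTree hy))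
      _ = (2 * (i + 1) : ℕ) := by rw [two_mul]; rfl

theorem edist_spanner_le_of_adj (hU : H.support ⊆ U) {x y : ℕ} (h : H.Adj x y) :
    (spanner H).edist x y ≤ (2 * Nat.log 2 U.card : ℕ) := by
  refine (edist_spanner_le_or_mem_unknownNbrs h _).resolve_right ?_
  rw [unknownNbrs_eq_empty hU le_rfl]
  exact Finset.notMem_empty y

theorem sum_degree_spanner_le (hU : H.support ⊆ U) :
    ∑ x ∈ U, (spanner H).degree x ≤ 2 * (U.card * Nat.log 2 U.card) := by
  classical
  set A := U ×ˢ Finset.range (Nat.log 2 U.card) with hA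
  let chosen (p : ℕ × ℕ) : ℕ := (link H p.2 p.1).getD 0
  have hsub : (U.sigma fun x => (spanner H).neighborFinset x) ⊆
      A.image (fun p => (⟨p.1, chosen p⟩ : (_ : ℕ) × ℕ)) ∪
      A.image (fun p => (⟨chosen p, p.1⟩ : (_ : ℕ) × ℕ)) := by
    rintro ⟨x, y⟩ h
    simp only [Finset.mem_sigma, SimpleGraph.mem_neighborFinset] at h
    have hy : y ∈ U :=
      mem_of_adj_of_support_subset (support_spanner_subset hU) h.2.symm
    obtain ⟨hx, j, hj | hj⟩ := h
    · refine Finset.mem_union_left _ (Finset.mem_image.2 ⟨(x, j), ?_, by simp [chosen, hj]⟩)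
      simp [hA, hx, link_lt hU hj]
    · refine Finset.mem_union_right _ (Finset.mem_image.2 ⟨(y, j), ?_, by simp [chosen, hj]⟩)
      simp [hA, hy, link_lt hU hj]
  calc ∑ x ∈ U, (spanner H).degree x
      = (U.sigma fun x => (spanner H).neighborFinset x).card := (Finset.card_sigma _ _).symm
    _ ≤ A.card + A.card := (Finset.card_le_card hsub).trans <| (Finset.card_union_le _ _).trans <|
        add_le_add Finset.card_image_le Finset.card_image_le
    _ = 2 * (U.card * Nat.log 2 U.card) := by
        rw [← two_mul, hA, Finset.card_product, Finset.card_range]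

theorem exists_forwards_of_send_ne_none {t : ℕ} :
    ∃ i k, ∀ x y, (spannerRun H t x).send y ≠ none → Forwards H i k x y := by
  obtain ⟨i, k, hk, rfl⟩ := exists_eq_iterStart_add t
  refine ⟨i, k, fun x y h => ?_⟩
  obtain ⟨R, hR⟩ := Option.ne_none_iff_exists'.1 h
  exact (((spannerInvariant_spannerRun hk x).send_eq_some_iff hk).1 hR).1

theorem spanner_adj_of_send_ne_none {t x y : ℕ} (h : (spannerRun H t x).send y ≠ none) :
    (spanner H).Adj x y := by
  obtain ⟨i, k, hfwd⟩ := exists_forwards_of_send_ne_none (H := H) (t := t)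
  exact (hfwd x y h).spanner_adj

theorem rumors_spannerRun_eq_empty (hU : H.support ⊆ U) {t : ℕ}
    (ht : iterStart (Nat.log 2 U.card) ≤ t) (x : ℕ) : (spannerRun H t x).rumors = ∅ := by
  obtain ⟨i, k, hk, rfl⟩ := exists_eq_iterStart_add t
  have hi : Nat.log 2 U.card ≤ i := le_of_iterStart_le hk ht
  clear ht
  refine Finset.eq_empty_of_forall_notMem fun v => ?_
  induction k generalizing x with
  | zero => simp [mem_rumors_iterStart, unknownNbrs_eq_empty hU hi]
  | succ k ih =>
    rw [rumors_spannerRun_succ (by omega), mem_rumorsAfter (by omega)]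
    simp [fun x => ih x (by omega)]

theorem send_spannerRun_eq_none (hU : H.support ⊆ U) {t : ℕ}
    (ht : iterStart (Nat.log 2 U.card) ≤ t) (x y : ℕ) : (spannerRun H t x).send y = none :=
  if_neg fun h => h.1.ne_empty (rumors_spannerRun_eq_empty hU ht x)

open Classical in
theorem card_forwards_le (U : Finset ℕ) (i k : ℕ) :
    ((U ×ˢ U).filter fun p => Forwards H i k p.1 p.2).card ≤ U.card := by
  rcases le_or_gt k i with hki | hki
  · refine Finset.card_le_card_of_injOn Prod.fst
      (fun p h => (Finset.mem_product.1 (Finset.mem_filter.1 h).1).1) ?_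
    rintro ⟨x, y⟩ h ⟨x', y'⟩ h' (rfl : x = x')
    simp only [Finset.coe_filter, Set.mem_ofPred_eq, Forwards, hki, hki.not_gt, true_and, false_and,
      or_false] at h h'
    rw [Option.some_injective _ (h.2.symm.trans h'.2)]
  · refine Finset.card_le_card_of_injOn Prod.snd
      (fun p h => (Finset.mem_product.1 (Finset.mem_filter.1 h).1).2) ?_
    rintro ⟨x, y⟩ h ⟨x', y'⟩ h' (rfl : y = y')
    simp only [Finset.coe_filter, Set.mem_ofPred_eq, Forwards, hki, hki.not_ge, true_and, false_and,
      false_or] at h h'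
    rw [Option.some_injective _ (h.2.symm.trans h'.2)]

open Classical in
theorem sum_card_send_spannerRun_le (hU : H.support ⊆ U) (t : ℕ) :
    ∑ r ∈ Finset.range t,
      ((U ×ˢ U).filter fun p => (spannerRun H r p.1).send p.2 ≠ none).card ≤
      iterStart (Nat.log 2 U.card) * U.card := by
  set T := iterStart (Nat.log 2 U.card)
  set m : ℕ → ℕ := fun r => ((U ×ˢ U).filter fun p => (spannerRun H r p.1).send p.2 ≠ none).card
  have hle (r : ℕ) : m r ≤ U.card := by
    obtain ⟨i, k, hfwd⟩ := exists_forwards_of_send_ne_none (H := H) (t := r)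
    exact (Finset.card_le_card (Finset.monotone_filter_right _ fun p _ => hfwd p.1 p.2)).trans
      (card_forwards_le U i k)
  have hzero (r : ℕ) (hr : r ∉ Finset.range T) : m r = 0 := by
    simp [m, send_spannerRun_eq_none hU (not_lt.1 (Finset.mem_range.not.1 hr))]
  calc ∑ r ∈ Finset.range t, m r ≤ ∑ r ∈ Finset.range (t + T), m r :=
        Finset.sum_le_sum_of_subset (Finset.range_mono (Nat.le_add_right t T))
    _ = ∑ r ∈ Finset.range T, m r := (Finset.sum_subset (Finset.range_mono (Nat.le_add_left T t))
        fun r _ => hzero r).symm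
    _ ≤ T * U.card := by
        simpa using Finset.sum_le_card_nsmul (Finset.range T) m U.card fun r _ => hle r

end spanner

/-- The position of a node in a kingdom, which is a rooted tree: the root of the tree, and the
parent and the depth of the node in it.  The parent of the root is the root itself. -/
structure Position where
  root : ℕ
  parent : ℕ
  depth : ℕ

/-- What a node has published about one phase of the election: its position in a kingdom; the roots
`found` of the kingdoms that meet the closed neighborhood of its subtree; the set `known` of all the
roots found by its kingdom, which is passed down from the root; and the union `reported` of the sets
that are known in the closed neighborhood of its subtree. -/
@[ext]
structure PhaseRecord where
  pos : Option Position
  found : Option (Finset ℕ)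
  known : Option (Finset ℕ)
  reported : Option (Finset ℕ)

open Classical in
/-- One step of a convergecast at the node `v` with neighbors `N`: the union of the values `val` in
the closed neighborhood of `v` and of the results `sub` at the children of `v`, as soon as all these
are present. -/
noncomputable def gather (v : ℕ) (N : Finset ℕ) (pos : ℕ → Option Position)
    (val sub : ℕ → Option (Finset ℕ)) : Option (Finset ℕ) :=
  if (∀ w ∈ insert v N, val w ≠ none) ∧
      ∀ w ∈ N, (pos w).map Position.parent = some v → sub w ≠ none then
    some ((insert v N).biUnion (fun w => (val w).getD ∅) ∪
      (N.filter fun w => (pos w).map Position.parent = some v).biUnion fun w => (sub w).getD ∅)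
  else none

section gather

variable {v : ℕ} {N : Finset ℕ} {pos : ℕ → Option Position} {val sub : ℕ → Option (Finset ℕ)}

theorem gather_ne_none (hval : ∀ w ∈ insert v N, val w ≠ none)
    (hsub : ∀ w ∈ N, (pos w).map Position.parent = some v → sub w ≠ none) :
    gather v N pos val sub ≠ none := by
  rw [gather, if_pos ⟨hval, hsub⟩]
  exact Option.some_ne_none _

variable {S : Finset ℕ}

theorem exists_val_subset_of_gather (h : gather v N pos val sub = some S) {w : ℕ}
    (hw : w ∈ insert v N) : ∃ S' ⊆ S, val w = some S' := by
  classical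
  obtain ⟨⟨hval, -⟩, hS⟩ := Option.ite_none_right_eq_some.1 h
  obtain rfl := Option.some_injective _ hS
  obtain ⟨S', hS'⟩ := Option.ne_none_iff_exists'.1 (hval w hw)
  have hsub := Finset.subset_biUnion_of_mem (fun w => (val w).getD ∅) hw
  rw [hS'] at hsub
  exact ⟨S', hsub.trans Finset.subset_union_left, hS'⟩

theorem exists_sub_subset_of_gather (h : gather v N pos val sub = some S) {w : ℕ} (hw : w ∈ N)
    (hchild : (pos w).map Position.parent = some v) : ∃ S' ⊆ S, sub w = some S' := by
  classical
  obtain ⟨⟨-, hsub⟩, hS⟩ := Option.ite_none_right_eq_some.1 h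
  obtain rfl := Option.some_injective _ hS
  obtain ⟨S', hS'⟩ := Option.ne_none_iff_exists'.1 (hsub w hw hchild)
  have hsub := Finset.subset_biUnion_of_mem (fun w => (sub w).getD ∅)
    ((Finset.mem_filter (p := fun w => (pos w).map Position.parent = some v)).2 ⟨hw, hchild⟩)
  rw [hS'] at hsub
  exact ⟨S', hsub.trans Finset.subset_union_right, hS'⟩

theorem exists_mem_of_mem_gather (h : gather v N pos val sub = some S) {x : ℕ} (hx : x ∈ S) :
    ∃ w S', (val w = some S' ∨ sub w = some S') ∧ x ∈ S' := by
  classical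
  have exists_of_mem_getD {o : Option (Finset ℕ)} (ho : x ∈ o.getD ∅) :
      ∃ S', o = some S' ∧ x ∈ S' := by
    cases o with
    | none => exact absurd ho (Finset.notMem_empty x)
    | some S' => exact ⟨S', rfl, ho⟩
  obtain ⟨-, hS⟩ := Option.ite_none_right_eq_some.1 h
  obtain rfl := Option.some_injective _ hS
  rw [Finset.mem_union, Finset.mem_biUnion, Finset.mem_biUnion] at hx
  obtain ⟨w, -, hw⟩ | ⟨w, -, hw⟩ := hx <;> obtain ⟨S', hS', hxS⟩ := exists_of_mem_getD hw
  exacts [⟨w, S', Or.inl hS', hxS⟩, ⟨w, S', Or.inr hS', hxS⟩]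

theorem gather_congr {pos' : ℕ → Option Position} {val' sub' : ℕ → Option (Finset ℕ)}
    (hpos : ∀ w ∈ N, pos w = pos' w) (hval : ∀ w ∈ insert v N, val w = val' w)
    (hsub : ∀ w ∈ N, sub w = sub' w) : gather v N pos val sub = gather v N pos' val' sub' := by
  classical
  have hchildren : (N.filter fun w => (pos w).map Position.parent = some v) =
      N.filter fun w => (pos' w).map Position.parent = some v :=
    Finset.filter_congr fun w hw => by rw [hpos w hw]
  have hcond : ((∀ w ∈ insert v N, val w ≠ none) ∧
      ∀ w ∈ N, (pos w).map Position.parent = some v → sub w ≠ none) ↔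
      (∀ w ∈ insert v N, val' w ≠ none) ∧
      ∀ w ∈ N, (pos' w).map Position.parent = some v → sub' w ≠ none :=
    and_congr (forall₂_congr fun w hw => by rw [hval w hw])
      (forall₂_congr fun w hw => by rw [hpos w hw, hsub w hw])
  refine if_congr hcond (congrArg some (congrArg₂ _ ?_ ?_)) rfl
  · exact Finset.biUnion_congr rfl fun w hw => by rw [hval w hw]
  · exact Finset.biUnion_congr hchildren fun w hw => by rw [hsub w (Finset.mem_filter.1 hw).1]

end gather

namespace PhaseRecord

/-- The record without entries. -/
def empty : PhaseRecord := ⟨none, none, none, none⟩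

/-- The root of the kingdom of a node, if the node has joined one. -/
def root (r : PhaseRecord) : Option ℕ := r.pos.map Position.root

open Classical in
/-- The new record of the node `v` with neighbors `N`, where `c` gives the old records of `v` and
its neighbors, and `q` says whether `v` qualifies as a root.  A root that finds no kingdom other
than its own has won, and it does not publish this set as `known`. -/
noncomputable def update (v : ℕ) (N : Finset ℕ) (q : Prop) (c : ℕ → PhaseRecord) : PhaseRecord where
  pos := (c v).pos.or <|
    if q then some ⟨v, v, 0⟩
    else (leastId (N.filter fun w => (c w).pos ≠ none)).bind fun w =>
      (c w).pos.map fun j => ⟨j.root, w, j.depth + 1⟩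
  found := (c v).found.or <|
    gather v N (fun w => (c w).pos) (fun w => (c w).root.map singleton) fun w => (c w).found
  known := (c v).known.or <| (c v).pos.bind fun j =>
    if j.depth = 0 then (c v).found.filter (· ≠ {v})
    else if j.parent ∈ N then (c j.parent).known else none
  reported := (c v).reported.or <|
    gather v N (fun w => (c w).pos) (fun w => (c w).known) fun w => (c w).reported

/-- The record `r'` extends the record `r`. -/
structure Extends (r r' : PhaseRecord) : Prop where
  pos : ∀ {j}, r.pos = some j → r'.pos = some j
  found : ∀ {S}, r.found = some S → r'.found = some S
  known : ∀ {S}, r.known = some S → r'.known = some S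
  reported : ∀ {S}, r.reported = some S → r'.reported = some S

theorem Extends.refl (r : PhaseRecord) : r.Extends r := ⟨id, id, id, id⟩

theorem Extends.trans {r r' r'' : PhaseRecord} (h : r.Extends r') (h' : r'.Extends r'') :
    r.Extends r'' :=
  ⟨fun e => h'.pos (h.pos e), fun e => h'.found (h.found e), fun e => h'.known (h.known e),
    fun e => h'.reported (h.reported e)⟩

theorem Extends.root {r r' : PhaseRecord} (h : r.Extends r') {x : ℕ} (hx : r.root = some x) :
    r'.root = some x := by
  obtain ⟨j, hj, rfl⟩ := Option.map_eq_some_iff.1 hx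
  rw [PhaseRecord.root, h.pos hj, Option.map_some]

theorem root_eq_some_iff {r : PhaseRecord} {x : ℕ} :
    r.root = some x ↔ ∃ j, r.pos = some j ∧ j.root = x := Option.map_eq_some_iff

variable {v : ℕ} {N : Finset ℕ} {q : Prop} {c : ℕ → PhaseRecord}

theorem extends_update : (c v).Extends (update v N q c) := by
  constructor <;> intro x hx <;> simp only [update, hx, Option.some_or]

theorem update_congr {c' : ℕ → PhaseRecord} (h : ∀ w ∈ insert v N, c w = c' w) :
    update v N q c = update v N q c' := by
  have hv : c v = c' v := h v (Finset.mem_insert_self v N)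
  have hN : ∀ w ∈ N, c w = c' w := fun w hw => h w (Finset.mem_insert_of_mem hw)
  ext1
  · have hfilter : (N.filter fun w => (c w).pos ≠ none) = N.filter fun w => (c' w).pos ≠ none :=
      Finset.filter_congr fun w hw => by rw [hN w hw]
    simp only [update, hv, hfilter]
    congr 2
    refine Option.bind_congr fun w hw => ?_
    rw [hN w (Finset.mem_filter.1 (mem_of_leastId_eq_some hw)).1]
  · simp only [update, hv]
    congr 1
    exact gather_congr (fun w hw => by rw [hN w hw]) (fun w hw => by rw [h w hw])
      fun w hw => by rw [hN w hw]
  · simp only [update, hv]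
    congr 2
    funext j
    split_ifs with _ hj
    exacts [rfl, by rw [hN _ hj], rfl]
  · simp only [update, hv]
    congr 1
    exact gather_congr (fun w hw => by rw [hN w hw]) (fun w hw => by rw [h w hw])
      fun w hw => by rw [hN w hw]

theorem pos_of_update {j : Position} (h : (update v N q c).pos = some j) :
    (c v).pos = some j ∨ j = ⟨v, v, 0⟩ ∧ q ∨
      ∃ w ∈ N, ∃ i, (c w).pos = some i ∧ j = ⟨i.root, w, i.depth + 1⟩ := by
  classical
  refine (Option.or_eq_some_iff.1 h).imp_right fun ⟨_, h⟩ => ?_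
  split_ifs at h with hq
  · exact Or.inl ⟨(Option.some_injective _ h).symm, hq⟩
  · obtain ⟨w, hw, h⟩ := Option.bind_eq_some_iff.1 h
    obtain ⟨i, hi, rfl⟩ := Option.map_eq_some_iff.1 h
    exact Or.inr ⟨w, (Finset.mem_filter.1 (mem_of_leastId_eq_some hw)).1, i, hi, rfl⟩

theorem pos_update_ne_none (h : q ∨ ∃ w ∈ N, (c w).pos ≠ none) :
    (update v N q c).pos ≠ none := by
  classical
  rw [update, ne_eq, Option.or_eq_none_iff, not_and]
  intro _
  by_cases hq : q
  · rw [if_pos hq]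
    exact Option.some_ne_none _
  · rw [if_neg hq]
    obtain ⟨w, hw⟩ := exists_leastId_eq_some <| (h.resolve_left hq).imp fun w hw =>
      (Finset.mem_filter (p := fun w => (c w).pos ≠ none)).2 hw
    rw [hw, Option.bind_some, Option.map_eq_none_iff]
    exact (Finset.mem_filter.1 (mem_of_leastId_eq_some hw)).2

theorem known_of_update {S : Finset ℕ} (h : (update v N q c).known = some S) :
    (c v).known = some S ∨ ∃ j, (c v).pos = some j ∧
      (j.depth = 0 ∧ (c v).found = some S ∧ S ≠ {v} ∨
        j.depth ≠ 0 ∧ (c j.parent).known = some S) := by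
  refine (Option.or_eq_some_iff.1 h).imp_right fun ⟨_, h⟩ => ?_
  obtain ⟨j, hj, h⟩ := Option.bind_eq_some_iff.1 h
  refine ⟨j, hj, ?_⟩
  split_ifs at h with hdepth
  · rw [Option.filter_eq_some_iff, decide_eq_true_iff] at h
    exact Or.inl ⟨hdepth, h⟩
  · exact Or.inr ⟨hdepth, h⟩

theorem known_update_ne_none {j : Position} (hj : (c v).pos = some j)
    (h : j.depth = 0 ∧ (∃ S, (c v).found = some S ∧ S ≠ {v}) ∨
      j.depth ≠ 0 ∧ j.parent ∈ N ∧ (c j.parent).known ≠ none) :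
    (update v N q c).known ≠ none := by
  rw [update, ne_eq, Option.or_eq_none_iff, not_and, hj, Option.bind_some]
  intro _
  obtain ⟨hdepth, S, hS, hne⟩ | ⟨hdepth, hN, hknown⟩ := h
  · rw [if_pos hdepth, hS, Option.filter_eq_none_iff]
    exact fun hall => hall S rfl (decide_eq_true hne)
  · rwa [if_neg hdepth, if_pos hN]

end PhaseRecord

/-- The node `v` with records `r` qualifies as a root of phase `p`: it is a root of the phase
before, and the largest one among the roots reported to it. -/
def Qualifies (v : ℕ) (r : ℕ → PhaseRecord) : ℕ → Prop
  | 0 => True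
  | p + 1 => (r p).pos = some ⟨v, v, 0⟩ ∧ ∃ S, (r p).reported = some S ∧ ∀ x ∈ S, x ≤ v

theorem Qualifies.mono {v p : ℕ} {r r' : ℕ → PhaseRecord} (h : Qualifies v r p)
    (hr : ∀ p, (r p).Extends (r' p)) : Qualifies v r' p := by
  cases p with
  | zero => trivial
  | succ p =>
    obtain ⟨hpos, S, hS, hle⟩ := h
    exact ⟨(hr p).pos hpos, S, (hr p).reported hS, hle⟩

/-- The node `v` with records `r` wins the election: it is the only root of some phase. -/
def Wins (v : ℕ) (r : ℕ → PhaseRecord) : Prop :=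
  ∃ p, (r p).pos = some ⟨v, v, 0⟩ ∧ (r p).found = some {v}

theorem Wins.mono {v : ℕ} {r r' : ℕ → PhaseRecord} (h : Wins v r)
    (hr : ∀ p, (r p).Extends (r' p)) : Wins v r' := by
  obtain ⟨p, hpos, hfound⟩ := h
  exact ⟨p, (hr p).pos hpos, (hr p).found hfound⟩

open Classical in
/-- The records after `t` rounds of the election on the network `L`, where only the nodes in
`awake r` take part in round `r`. -/
noncomputable def recordRun (L : SimpleGraph ℕ) [L.LocallyFinite] (awake : ℕ → Set ℕ) :
    ℕ → ℕ → ℕ → PhaseRecord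
  | 0, _, _ => .empty
  | t + 1, x, p =>
    if x ∈ awake t then
      .update x (L.neighborFinset x) (Qualifies x (recordRun L awake t x) p)
        fun w => recordRun L awake t w p
    else recordRun L awake t x p

/-- The results `sub` are those of a convergecast of the values `val` along the trees given by the
positions `pos`. -/
structure IsConvergecast (L : SimpleGraph ℕ) (pos : ℕ → Option Position)
    (val sub : ℕ → Option (Finset ℕ)) : Prop where
  val_subset : ∀ {v w S}, sub v = some S → w = v ∨ L.Adj v w → ∃ S' ⊆ S, val w = some S'
  sub_subset : ∀ {v w S j}, sub v = some S → L.Adj v w → pos w = some j → j.parent = v →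
    ∃ S' ⊆ S, sub w = some S'
  source : ∀ {v S x}, sub v = some S → x ∈ S → ∃ w S', val w = some S' ∧ x ∈ S'

theorem IsConvergecast.succ {L : SimpleGraph ℕ} [L.LocallyFinite]
    {pos pos' : ℕ → Option Position} {val val' sub sub' : ℕ → Option (Finset ℕ)}
    (h : IsConvergecast L pos val sub) (hpos : ∀ {v j}, pos v = some j → pos' v = some j)
    (hval : ∀ {v S}, val v = some S → val' v = some S)
    (hsub : ∀ {v S}, sub v = some S → sub' v = some S)
    (hnew : ∀ {v S}, sub' v = some S →
      sub v = some S ∨ gather v (L.neighborFinset v) pos val sub = some S)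
    (hval_pos : ∀ {v S}, val v = some S → ∃ j, pos v = some j) :
    IsConvergecast L pos' val' sub' := by
  have val_subset {v w : ℕ} {S : Finset ℕ} (hS : sub' v = some S) (hw : w = v ∨ L.Adj v w) :
      ∃ S' ⊆ S, val w = some S' := by
    obtain hS | hS := hnew hS
    · exact h.val_subset hS hw
    · exact exists_val_subset_of_gather hS
        (Finset.mem_insert.2 (hw.imp_right (L.mem_neighborFinset v w).2))
  refine ⟨fun hS hw => ?_, fun {v w S j} hS hw hj hparent => ?_, fun {v S x} hS hx => ?_⟩
  · obtain ⟨S', hS', hval'⟩ := val_subset hS hw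
    exact ⟨S', hS', hval hval'⟩
  · obtain ⟨_, -, hval'⟩ := val_subset hS (Or.inr hw)
    obtain ⟨i, hi⟩ := hval_pos hval'
    obtain rfl : i = j := Option.some_injective _ ((hpos hi).symm.trans hj)
    suffices ∃ S' ⊆ S, sub w = some S' from this.imp fun S' => And.imp_right hsub
    obtain hS | hS := hnew hS
    · exact h.sub_subset hS hw hi hparent
    · exact exists_sub_subset_of_gather hS ((L.mem_neighborFinset v w).2 hw)
        (by rw [hi, Option.map_some, hparent])
  · suffices ∃ w S', val w = some S' ∧ x ∈ S' from
      this.imp fun w => Exists.imp fun S' => And.imp_left hval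
    obtain hS | hS := hnew hS
    · exact h.source hS hx
    · obtain ⟨w, S', hS' | hS', hxS⟩ := exists_mem_of_mem_gather hS hx
      exacts [⟨w, S', hS', hxS⟩, h.source hS' hxS]

section recordRun

variable {L : SimpleGraph ℕ} [L.LocallyFinite] {awake : ℕ → Set ℕ}

theorem recordRun_succ_of_mem {t x p : ℕ} (hx : x ∈ awake t) :
    recordRun L awake (t + 1) x p =
      .update x (L.neighborFinset x) (Qualifies x (recordRun L awake t x) p)
        fun w => recordRun L awake t w p := by
  rw [recordRun, if_pos hx]

theorem recordRun_extends_succ (t x p : ℕ) :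
    (recordRun L awake t x p).Extends (recordRun L awake (t + 1) x p) := by
  rw [recordRun]
  split_ifs
  · exact PhaseRecord.extends_update (c := fun w => recordRun L awake t w p)
  · exact .refl _

theorem recordRun_extends {s t : ℕ} (hst : s ≤ t) (x p : ℕ) :
    (recordRun L awake s x p).Extends (recordRun L awake t x p) := by
  induction t, hst using Nat.le_induction with
  | base => exact .refl _
  | succ t _ ih => exact ih.trans (recordRun_extends_succ t x p)

end recordRun

section election

variable {L : SimpleGraph ℕ} {U : Finset ℕ}

/-- The relations between the records `c v p` of the nodes `v` about the phases `p` that hold at all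
times of the election. -/
structure ElectionInvariant (L : SimpleGraph ℕ) (U : Finset ℕ) (c : ℕ → ℕ → PhaseRecord) :
    Prop where
  mem : ∀ {v p j}, (c v p).pos = some j → v ∈ U
  pos : ∀ {v p j}, (c v p).pos = some j → j = ⟨v, v, 0⟩ ∧ Qualifies v (c v) p ∨
    ∃ w, L.Adj v w ∧ ∃ i, (c w p).pos = some i ∧ j = ⟨i.root, w, i.depth + 1⟩
  found : ∀ p, IsConvergecast L (fun v => (c v p).pos) (fun v => (c v p).root.map singleton)
    fun v => (c v p).found
  known : ∀ {v p S}, (c v p).known = some S →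
    ∃ j, (c v p).pos = some j ∧ (c j.root p).found = some S ∧ S ≠ {j.root}
  reported : ∀ p, IsConvergecast L (fun v => (c v p).pos) (fun v => (c v p).known)
    fun v => (c v p).reported

namespace ElectionInvariant

variable {c c' : ℕ → ℕ → PhaseRecord}

theorem pos_succ [L.LocallyFinite] (h : ElectionInvariant L U c) {v p : ℕ} {j : Position}
    (hj : (PhaseRecord.update v (L.neighborFinset v) (Qualifies v (c v) p) fun w => c w p).pos =
      some j) :
    j = ⟨v, v, 0⟩ ∧ Qualifies v (c v) p ∨
      ∃ w, L.Adj v w ∧ ∃ i, (c w p).pos = some i ∧ j = ⟨i.root, w, i.depth + 1⟩ := by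
  obtain hj | hj | ⟨w, hw, hj⟩ := PhaseRecord.pos_of_update hj
  exacts [h.pos hj, Or.inl hj, Or.inr ⟨w, (L.mem_neighborFinset v w).1 hw, hj⟩]

theorem known_succ (h : ElectionInvariant L U c) {v p : ℕ} {N S : Finset ℕ} {q : Prop}
    (hS : (PhaseRecord.update v N q fun w => c w p).known = some S) :
    ∃ j, (c v p).pos = some j ∧ (c j.root p).found = some S ∧ S ≠ {j.root} := by
  obtain hS | ⟨j, hj, ⟨hdepth, hS, hne⟩ | ⟨hdepth, hS⟩⟩ := PhaseRecord.known_of_update hS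
  · exact h.known hS
  · obtain ⟨rfl, -⟩ | ⟨w, -, i, -, rfl⟩ := h.pos hj
    · exact ⟨_, hj, hS, hne⟩
    · exact absurd hdepth (Nat.succ_ne_zero i.depth)
  · obtain ⟨rfl, -⟩ | ⟨w, -, i, hi, rfl⟩ := h.pos hj
    · exact absurd rfl hdepth
    · obtain ⟨i', hi', hfound⟩ := h.known hS
      obtain rfl : i = i' := Option.some_injective _ (hi.symm.trans hi')
      exact ⟨_, hj, hfound⟩

theorem succ [L.LocallyFinite] (h : ElectionInvariant L U c)
    (hc : ∀ v, c' v = c v ∨ v ∈ U ∧ c' v = fun p =>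
      .update v (L.neighborFinset v) (Qualifies v (c v) p) fun w => c w p) :
    ElectionInvariant L U c' := by
  have hle (v p : ℕ) : (c v p).Extends (c' v p) := by
    obtain hv | ⟨-, hv⟩ := hc v <;> rw [hv]
    exacts [.refl _, PhaseRecord.extends_update (c := fun w => c w p)]
  refine
    { mem := fun {v p j} hj => ?_
      pos := fun {v p j} hj => ?_
      found := fun p => (h.found p).succ (hle _ p).pos ?_ (hle _ p).found (fun {v S} hS => ?_) ?_
      known := fun {v p S} hS => ?_
      reported := fun p => (h.reported p).succ (hle _ p).pos (hle _ p).known (hle _ p).reported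
        (fun {v S} hS => ?_) fun hS => (h.known hS).imp fun _ => And.left }
  · obtain hv | ⟨hv, -⟩ := hc v
    exacts [h.mem (hv ▸ hj), hv]
  · suffices hj : j = ⟨v, v, 0⟩ ∧ Qualifies v (c v) p ∨
        ∃ w, L.Adj v w ∧ ∃ i, (c w p).pos = some i ∧ j = ⟨i.root, w, i.depth + 1⟩ from
      hj.imp (And.imp_right fun hq => hq.mono (hle v)) <| Exists.imp fun w =>
        And.imp_right <| Exists.imp fun i => And.imp_left (hle w p).pos
    obtain hv | ⟨-, hv⟩ := hc v <;> rw [hv] at hj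
    exacts [h.pos hj, h.pos_succ hj]
  · intro v S hS
    obtain ⟨x, hx, hxS⟩ := Option.map_eq_some_iff.1 hS
    exact Option.map_eq_some_iff.2 ⟨x, (hle v p).root hx, hxS⟩
  · obtain hv | ⟨-, hv⟩ := hc v <;> rw [hv] at hS
    exacts [Or.inl hS, (Option.or_eq_some_iff.1 hS).imp_right And.right]
  · intro v S hS
    obtain ⟨x, hx, -⟩ := Option.map_eq_some_iff.1 hS
    exact (PhaseRecord.root_eq_some_iff.1 hx).imp fun _ => And.left
  · suffices ∃ j, (c v p).pos = some j ∧ (c j.root p).found = some S ∧ S ≠ {j.root} from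
      this.imp fun j => And.imp (hle v p).pos (And.imp_left (hle j.root p).found)
    obtain hv | ⟨-, hv⟩ := hc v <;> rw [hv] at hS
    exacts [h.known hS, h.known_succ hS]
  · obtain hv | ⟨-, hv⟩ := hc v <;> rw [hv] at hS
    exacts [Or.inl hS, (Option.or_eq_some_iff.1 hS).imp_right And.right]

theorem recordRun [L.LocallyFinite] {awake : ℕ → Set ℕ} (hawake : ∀ t, awake t ⊆ U)
    (t : ℕ) : ElectionInvariant L U (recordRun L awake t) := by
  induction t with
  | zero => constructor <;> intros <;> (try constructor) <;> intros <;> contradiction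
  | succ t ih =>
    refine ih.succ fun v => ?_
    by_cases hv : v ∈ awake t
    · exact Or.inr ⟨hawake t hv, funext fun p => recordRun_succ_of_mem hv⟩
    · exact Or.inl (funext fun p => by rw [_root_.recordRun, if_neg hv])

variable (h : ElectionInvariant L U c) {p : ℕ}
include h

theorem pos_induction {P : ℕ → Position → Prop}
    (root : ∀ v, (c v p).pos = some ⟨v, v, 0⟩ → P v ⟨v, v, 0⟩)
    (child : ∀ v w j, L.Adj v w → (c w p).pos = some j →
      (c v p).pos = some ⟨j.root, w, j.depth + 1⟩ → P w j → P v ⟨j.root, w, j.depth + 1⟩)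
    {v : ℕ} {j : Position} (hj : (c v p).pos = some j) : P v j := by
  obtain ⟨d, hd⟩ : ∃ d, j.depth = d := ⟨_, rfl⟩
  induction d generalizing v j with
  | zero =>
    obtain ⟨rfl, -⟩ | ⟨w, -, i, -, rfl⟩ := h.pos hj
    exacts [root v hj, absurd hd (Nat.succ_ne_zero i.depth)]
  | succ d ih =>
    obtain ⟨rfl, -⟩ | ⟨w, hw, i, hi, rfl⟩ := h.pos hj
    · exact absurd hd.symm (Nat.succ_ne_zero d)
    · exact child v w i hw hi hj (ih hi (Nat.succ_injective hd))

theorem pos_root {v x : ℕ} (hx : (c v p).root = some x) : (c x p).pos = some ⟨x, x, 0⟩ := by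
  obtain ⟨j, hj, rfl⟩ := PhaseRecord.root_eq_some_iff.1 hx
  exact h.pos_induction (P := fun _ j => (c j.root p).pos = some ⟨j.root, j.root, 0⟩)
    (fun _ hv => hv) (fun _ _ _ _ _ _ ih => ih) hj

theorem exists_subset_of_root {val sub : ℕ → Option (Finset ℕ)}
    (hsub : IsConvergecast L (fun v => (c v p).pos) val sub) {v x : ℕ} {S : Finset ℕ}
    (hx : (c v p).root = some x) (hS : sub x = some S) : ∃ S' ⊆ S, sub v = some S' := by
  obtain ⟨j, hj, rfl⟩ := PhaseRecord.root_eq_some_iff.1 hx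
  revert hS
  refine h.pos_induction (P := fun v j => sub j.root = some S → ∃ S' ⊆ S, sub v = some S')
    (fun _ _ hS => ⟨S, subset_rfl, hS⟩) (fun v w j hvw _ hv ih hS => ?_) hj
  obtain ⟨S', hS', hw⟩ := ih hS
  obtain ⟨S'', hS'', hv⟩ := hsub.sub_subset hw hvw.symm hv rfl
  exact ⟨S'', hS''.trans hS', hv⟩

theorem exists_root_of_found {v w : ℕ} {S : Finset ℕ} (hS : (c v p).found = some S)
    (hw : w = v ∨ L.Adj v w) : ∃ x ∈ S, (c w p).root = some x := by
  obtain ⟨S', hS', hval⟩ := (h.found p).val_subset hS hw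
  obtain ⟨x, hx, rfl⟩ := Option.map_eq_some_iff.1 hval
  exact ⟨x, hS' (Finset.mem_singleton_self x), hx⟩

theorem pos_of_mem_found {v x : ℕ} {S : Finset ℕ} (hS : (c v p).found = some S) (hx : x ∈ S) :
    (c x p).pos = some ⟨x, x, 0⟩ := by
  obtain ⟨w, S', hS', hxS⟩ := (h.found p).source hS hx
  obtain ⟨y, hy, rfl⟩ := Option.map_eq_some_iff.1 hS'
  obtain rfl := Finset.mem_singleton.1 hxS
  exact h.pos_root hy

theorem pos_of_mem_reported {v x : ℕ} {S : Finset ℕ} (hS : (c v p).reported = some S)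
    (hx : x ∈ S) : (c x p).pos = some ⟨x, x, 0⟩ := by
  obtain ⟨w, S', hS', hxS⟩ := (h.reported p).source hS hx
  obtain ⟨j, -, hfound, -⟩ := h.known hS'
  exact h.pos_of_mem_found hfound hxS

/-! ### The number of phases -/

variable {x : ℕ} {S : Finset ℕ}

theorem exists_mem_root_of_adj (hS : (c x p).found = some S) {v w : ℕ} (hv : (c v p).root = some x)
    (hvw : L.Adj v w) : ∃ y ∈ S, (c w p).root = some y := by
  obtain ⟨S', hS', hfound⟩ := h.exists_subset_of_root (h.found p) hv hS
  obtain ⟨y, hy, hw⟩ := h.exists_root_of_found hfound (Or.inr hvw)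
  exact ⟨y, hS' hy, hw⟩

theorem mem_of_adj (hS : (c x p).found = some S) {v w y : ℕ} (hv : (c v p).root = some x)
    (hvw : L.Adj v w) (hw : (c w p).root = some y) : y ∈ S := by
  obtain ⟨z, hz, hw'⟩ := h.exists_mem_root_of_adj hS hv hvw
  rwa [Option.some_injective _ (hw.symm.trans hw')]

theorem found_of_pos_succ (hx : (c x (p + 1)).pos = some ⟨x, x, 0⟩) :
    (c x p).pos = some ⟨x, x, 0⟩ ∧ ∃ S R, (c x p).found = some S ∧ S ≠ {x} ∧
      (c x p).reported = some R ∧ S ⊆ R ∧ ∀ z ∈ R, z ≤ x := by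
  obtain ⟨-, hpos, R, hR, hle⟩ | ⟨w, -, i, -, hi⟩ := h.pos hx
  · obtain ⟨S, hSR, hS⟩ := (h.reported p).val_subset hR (Or.inl rfl)
    obtain ⟨j, hj, hfound, hne⟩ := h.known hS
    obtain rfl := Option.some_injective _ (hpos.symm.trans hj)
    exact ⟨hpos, S, R, hfound, hne, hR, hSR, hle⟩
  · exact absurd (congrArg Position.depth hi) (Nat.succ_ne_zero _).symm

variable (hconn : ∀ x ∈ U, ∀ y ∈ U, L.Reachable x y)
include hconn

theorem root_eq_of_forall_adj (hx : (c x p).pos = some ⟨x, x, 0⟩)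
    (hadj : ∀ v w, L.Adj v w → (c v p).root = some x → (c w p).root = some x) {v : ℕ} (hv : v ∈ U) :
    (c v p).root = some x := by
  have hreach := (L.reachable_iff_reflTransGen x v).1 (hconn x (h.mem hx) v hv)
  clear hv
  induction hreach with
  | refl => exact PhaseRecord.root_eq_some_iff.2 ⟨_, hx, rfl⟩
  | tail _ hvw ih => exact hadj _ _ hvw ih

theorem root_eq_of_found (hx : (c x p).pos = some ⟨x, x, 0⟩) (hfound : (c x p).found = some {x})
    {v : ℕ} (hv : v ∈ U) : (c v p).root = some x := by
  refine h.root_eq_of_forall_adj hconn hx (fun v w hvw hv => ?_) hv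
  obtain ⟨y, hy, hw⟩ := h.exists_mem_root_of_adj hfound hv hvw
  rwa [Finset.mem_singleton.1 hy] at hw

theorem exists_adj_root_ne (hx : (c x p).pos = some ⟨x, x, 0⟩) (hS : (c x p).found = some S)
    (hne : S ≠ {x}) :
    ∃ v w y, L.Adj v w ∧ (c v p).root = some x ∧ (c w p).root = some y ∧ y ≠ x := by
  by_contra! hroot
  refine hne (Finset.eq_singleton_iff_unique_mem.2 ⟨?_, fun y hy => ?_⟩)
  · obtain ⟨y, hy, hxy⟩ := h.exists_root_of_found hS (Or.inl rfl)
    rw [PhaseRecord.root, hx] at hxy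
    rwa [← Option.some_injective _ hxy] at hy
  · have hpos := h.pos_of_mem_found hS hy
    have hyx := h.root_eq_of_forall_adj hconn hx (fun v w hvw hv => by
      obtain ⟨z, -, hw⟩ := h.exists_mem_root_of_adj hS hv hvw
      rwa [hroot v w z hvw hv hw] at hw) (h.mem hpos)
    rw [PhaseRecord.root, hpos] at hyx
    exact Option.some_injective _ hyx

theorem exists_pos_succ_ne (hx : (c x (p + 1)).pos = some ⟨x, x, 0⟩) :
    ∃ y S, (c y p).pos = some ⟨y, y, 0⟩ ∧ (c y (p + 1)).pos ≠ some ⟨y, y, 0⟩ ∧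
      (c y p).found = some S ∧ x ∈ S ∧ ∀ z ∈ S, z ≤ x := by
  obtain ⟨hpos, S, R, hS, hne, hR, hSR, hle⟩ := h.found_of_pos_succ hx
  obtain ⟨v, w, y, hvw, hv, hw, hyx⟩ := h.exists_adj_root_ne hconn hpos hS hne
  obtain ⟨R', hRR', hR'⟩ := h.exists_subset_of_root (h.reported p) hv hR
  obtain ⟨T, hTR', hT⟩ := (h.reported p).val_subset hR' (Or.inr hvw)
  have hfound : (c y p).found = some T := by
    obtain ⟨j, hj, hfound, -⟩ := h.known hT
    rw [PhaseRecord.root, hj] at hw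
    rwa [← Option.some_injective _ hw]
  have hxT : x ∈ T := h.mem_of_adj hfound hw hvw.symm hv
  refine ⟨y, T, h.pos_root hw, fun hy => ?_, hfound, hxT, fun z hz => hle z (hRR' (hTR' hz))⟩
  have hy_le : y ≤ x := hle y (hSR (h.mem_of_adj hS hv hvw hw))
  obtain ⟨-, T', R'', hT', -, -, hTR'', hle'⟩ := h.found_of_pos_succ hy
  obtain rfl := Option.some_injective _ (hfound.symm.trans hT')
  exact hyx (le_antisymm hy_le (hle' x (hTR'' hxT)))

end ElectionInvariant

open Classical in
/-- The roots of the kingdoms of phase `p`. -/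
noncomputable def phaseRoots (U : Finset ℕ) (c : ℕ → ℕ → PhaseRecord) (p : ℕ) : Finset ℕ :=
  {x ∈ U | (c x p).pos = some ⟨x, x, 0⟩}

namespace ElectionInvariant

variable {c : ℕ → ℕ → PhaseRecord} (h : ElectionInvariant L U c) {p x : ℕ}
include h

theorem mem_phaseRoots : x ∈ phaseRoots U c p ↔ (c x p).pos = some ⟨x, x, 0⟩ := by
  classical exact Finset.mem_filter.trans (and_iff_right_of_imp h.mem)

theorem phaseRoots_antitone : Antitone (phaseRoots U c) :=
  antitone_nat_of_succ_le fun _ _ hx =>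
    h.mem_phaseRoots.2 (h.found_of_pos_succ (h.mem_phaseRoots.1 hx)).1

variable (hconn : ∀ x ∈ U, ∀ y ∈ U, L.Reachable x y)
include hconn

/-- A root `x` that survives the phase is the maximum of the set found by some root that does not
survive, so different survivors give different losers. -/
theorem two_mul_card_phaseRoots_succ_le (p : ℕ) :
    2 * (phaseRoots U c (p + 1)).card ≤ (phaseRoots U c p).card := by
  have hsub := h.phaseRoots_antitone p.le_succ
  choose! f S hf hf_succ hfound hmem hle using
    fun x hx => h.exists_pos_succ_ne hconn (x := x) (p := p) hx
  have hcard : (phaseRoots U c (p + 1)).card ≤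
      (phaseRoots U c p \ phaseRoots U c (p + 1)).card := by
    refine Finset.card_le_card_of_injOn f (fun x hx => ?_) fun x hx y hy hxy => ?_
    · rw [Finset.mem_coe, h.mem_phaseRoots] at hx
      rw [Finset.mem_coe, Finset.mem_sdiff, h.mem_phaseRoots, h.mem_phaseRoots]
      exact ⟨hf x hx, hf_succ x hx⟩
    · rw [Finset.mem_coe, h.mem_phaseRoots] at hx hy
      have hS : S x = S y := Option.some_injective _ ((hfound x hx).symm.trans (hxy ▸ hfound y hy))
      exact le_antisymm (hle y hy x (hS ▸ hmem x hx)) (hle x hx y (hS ▸ hmem y hy))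
  rw [Finset.card_sdiff_of_subset hsub] at hcard
  have := Finset.card_le_card hsub
  lia

theorem two_pow_mul_card_phaseRoots_le (p : ℕ) : 2 ^ p * (phaseRoots U c p).card ≤ U.card := by
  induction p with
  | zero =>
    classical
    rw [pow_zero, one_mul]
    exact Finset.card_filter_le _ _
  | succ p ih =>
    rw [pow_succ, mul_assoc]
    exact (Nat.mul_le_mul_left _ (h.two_mul_card_phaseRoots_succ_le hconn p)).trans ih

theorem phase_le_log {v : ℕ} {j : Position} (hj : (c v p).pos = some j) : p ≤ Nat.log 2 U.card := by
  have hroot := h.mem_phaseRoots.2 (h.pos_root (PhaseRecord.root_eq_some_iff.2 ⟨j, hj, rfl⟩))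
  exact Nat.le_log_of_pow_le one_lt_two <|
    (Nat.le_mul_of_pos_right _ (Finset.card_pos.2 ⟨_, hroot⟩)).trans
      (h.two_pow_mul_card_phaseRoots_le hconn p)

theorem wins_unique {v w : ℕ} (hv : Wins v (c v)) (hw : Wins w (c w)) : v = w := by
  have root_eq {v w p : ℕ} (hv : (c v p).pos = some ⟨v, v, 0⟩) (hfound : (c v p).found = some {v})
      (hw : (c w p).pos = some ⟨w, w, 0⟩) : v = w := by
    have hroot := h.root_eq_of_found hconn hv hfound (h.mem hw)
    rw [PhaseRecord.root, hw] at hroot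
    exact (Option.some_injective _ hroot).symm
  have not_lt {v w p q : ℕ} (hv : (c v p).pos = some ⟨v, v, 0⟩) (hfound : (c v p).found = some {v})
      (hw : (c w q).pos = some ⟨w, w, 0⟩) : ¬ p < q := fun hpq => by
    have hw := h.mem_phaseRoots.1 (h.phaseRoots_antitone hpq (h.mem_phaseRoots.2 hw))
    obtain ⟨hw, S, -, hS, hne, -⟩ := h.found_of_pos_succ hw
    obtain rfl := root_eq hv hfound hw
    exact hne (Option.some_injective _ (hS.symm.trans hfound))
  obtain ⟨p, hvpos, hvfound⟩ := hv
  obtain ⟨q, hwpos, hwfound⟩ := hw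
  obtain rfl : p = q := le_antisymm (Nat.le_of_not_lt (not_lt hwpos hwfound hvpos))
    (Nat.le_of_not_lt (not_lt hvpos hvfound hwpos))
  exact root_eq hvpos hvfound hwpos

end ElectionInvariant

/-! ### The number of changes of a record -/

namespace PhaseRecord

/-- The number of entries of a record. -/
def size (r : PhaseRecord) : ℕ :=
  r.pos.isSome.toNat + r.found.isSome.toNat + r.known.isSome.toNat + r.reported.isSome.toNat

theorem size_le (r : PhaseRecord) : r.size ≤ 4 :=
  add_le_add (add_le_add (add_le_add (Bool.toNat_le _) (Bool.toNat_le _)) (Bool.toNat_le _))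
    (Bool.toNat_le _)

theorem Extends.eq_of_size_le {r r' : PhaseRecord} (h : r.Extends r')
    (hsize : r'.size ≤ r.size) : r = r' := by
  have toNat_le {α : Type} {a b : Option α} (hab : ∀ {x}, a = some x → b = some x) :
      a.isSome.toNat ≤ b.isSome.toNat := by
    cases a with
    | none => exact Nat.zero_le _
    | some x => rw [hab rfl]
  have eq_of_le {α : Type} {a b : Option α} (hab : ∀ {x}, a = some x → b = some x)
      (hle : b.isSome.toNat ≤ a.isSome.toNat) : a = b := by
    cases a with
    | none => cases b with
      | none => rfl
      | some x => exact absurd hle (Nat.not_succ_le_zero 0)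
    | some x => exact (hab rfl).symm
  have hpos := toNat_le h.pos
  have hfound := toNat_le h.found
  have hknown := toNat_le h.known
  have hreported := toNat_le h.reported
  unfold size at hsize
  ext1
  exacts [eq_of_le h.pos (by lia), eq_of_le h.found (by lia), eq_of_le h.known (by lia),
    eq_of_le h.reported (by lia)]

theorem Extends.size_le {r r' : PhaseRecord} (h : r.Extends r') : r.size ≤ r'.size := by
  by_contra! hlt
  exact hlt.ne' (congrArg size (h.eq_of_size_le hlt.le))

end PhaseRecord

theorem ElectionInvariant.eq_empty_of_log_lt {c : ℕ → ℕ → PhaseRecord}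
    (h : ElectionInvariant L U c) (hconn : ∀ x ∈ U, ∀ y ∈ U, L.Reachable x y) {p : ℕ}
    (hp : Nat.log 2 U.card < p) (v : ℕ) : c v p = .empty := by
  have hpos : (c v p).pos = none := Option.eq_none_iff_forall_ne_some.2 fun j hj =>
    hp.not_ge (h.phase_le_log hconn hj)
  have hknown : (c v p).known = none := Option.eq_none_iff_forall_ne_some.2 fun S hS => by
    obtain ⟨j, hj, -⟩ := h.known hS
    exact Option.some_ne_none j (hj.symm.trans hpos)
  ext1
  · exact hpos
  · refine Option.eq_none_iff_forall_ne_some.2 fun S hS => ?_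
    obtain ⟨x, -, hx⟩ := h.exists_root_of_found hS (Or.inl rfl)
    rw [PhaseRecord.root, hpos] at hx
    exact Option.some_ne_none x hx.symm
  · exact hknown
  · refine Option.eq_none_iff_forall_ne_some.2 fun S hS => ?_
    obtain ⟨S', -, hS'⟩ := (h.reported p).val_subset hS (Or.inl rfl)
    exact Option.some_ne_none S' (hS'.symm.trans hknown)

theorem card_filter_ne_le {α : Type*} [DecidableEq α] (f : ℕ → α) (μ : α → ℕ)
    (hμ : ∀ r, f (r + 1) ≠ f r → μ (f r) < μ (f (r + 1))) (t : ℕ) :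
    ((Finset.range t).filter fun r => f r ≠ f (r - 1)).card ≤ μ (f (t - 1)) := by
  induction t with
  | zero => exact Nat.zero_le _
  | succ t ih =>
    rw [Finset.range_add_one, Finset.filter_insert]
    split_ifs with hne
    · cases t with
      | zero => exact absurd rfl hne
      | succ t => exact (Finset.card_insert_le _ _).trans (ih.trans_lt (hμ t hne))
    · exact ih.trans_eq (congrArg μ (not_not.1 hne).symm)

open Classical in
theorem card_recordRun_ne_le [L.LocallyFinite] {awake : ℕ → Set ℕ} (hawake : ∀ t, awake t ⊆ U)
    (hconn : ∀ x ∈ U, ∀ y ∈ U, L.Reachable x y) (x t : ℕ) :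
    ((Finset.range t).filter fun r =>
      recordRun L awake r x ≠ recordRun L awake (r - 1) x).card ≤ 4 * (Nat.log 2 U.card + 1) := by
  set P := Nat.log 2 U.card + 1
  let μ (r : ℕ → PhaseRecord) : ℕ := ∑ p ∈ Finset.range P, (r p).size
  have hμ_le (r : ℕ → PhaseRecord) : μ r ≤ 4 * P :=
    (Finset.sum_le_card_nsmul _ _ 4 fun p _ => (r p).size_le).trans
      (by rw [Finset.card_range, smul_eq_mul, mul_comm])
  refine (card_filter_ne_le (fun r => recordRun L awake r x) μ (fun r hne => ?_) t).trans (hμ_le _)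
  have hext (p : ℕ) : (recordRun L awake r x p).Extends (recordRun L awake (r + 1) x p) :=
    recordRun_extends_succ r x p
  refine Finset.sum_lt_sum (fun p _ => (hext p).size_le) ?_
  contrapose! hne
  funext p
  obtain hp | hp := lt_or_ge p P
  · exact ((hext p).eq_of_size_le (hne p (Finset.mem_range.2 hp))).symm
  · rw [(ElectionInvariant.recordRun hawake _).eq_empty_of_log_lt hconn hp,
      (ElectionInvariant.recordRun hawake _).eq_empty_of_log_lt hconn hp]

/-! ### The duration of the election -/

/-- The setting of the election: `L` is a network on the nodes `U` of diameter at most `K`, in which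
nodes wake up at different times, but not later than in round `T`. -/
structure ElectionSetup (L : SimpleGraph ℕ) (U : Finset ℕ) (awake : ℕ → Set ℕ) (T K : ℕ) :
    Prop where
  support_subset : L.support ⊆ U
  edist_le : ∀ x ∈ U, ∀ y ∈ U, L.edist x y ≤ K
  awake_mono : Monotone awake
  awake_subset : ∀ t, awake t ⊆ U
  subset_awake : (U : Set ℕ) ⊆ awake T

theorem ne_none_of_forall_eq_some {α : Type*} {a b : Option α} (h : ∀ {x}, a = some x → b = some x)
    (ha : a ≠ none) : b ≠ none := by
  obtain ⟨x, hx⟩ := Option.ne_none_iff_exists'.1 ha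
  exact (h hx).symm ▸ Option.some_ne_none x

/-- In phase `p`, all nodes in `U` have joined kingdoms of depth at most `d` by time `t`. -/
def KingdomsFormed (L : SimpleGraph ℕ) [L.LocallyFinite] (U : Finset ℕ) (awake : ℕ → Set ℕ)
    (p d t : ℕ) : Prop :=
  ∀ x ∈ U, ∃ j, (recordRun L awake t x p).pos = some j ∧ j.depth ≤ d

variable [L.LocallyFinite] {awake : ℕ → Set ℕ} {p d t : ℕ}

theorem KingdomsFormed.mono {t' : ℕ} (h : KingdomsFormed L U awake p d t) (htt' : t ≤ t') :
    KingdomsFormed L U awake p d t' :=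
  fun x hx => (h x hx).imp fun _ => And.imp_left (recordRun_extends htt' x p).pos

theorem add_depth_lt {s x : ℕ} {j : Position} (hs : ∀ x, (recordRun L awake s x p).pos = none)
    (hj : (recordRun L awake t x p).pos = some j) : s + j.depth < t := by
  induction t generalizing x j with
  | zero => exact absurd hj (Option.some_ne_none j).symm
  | succ t ih =>
    have hst : s < t + 1 := by
      by_contra! hle
      exact Option.some_ne_none j (((recordRun_extends hle x p).pos hj).symm.trans (hs x))
    rw [recordRun] at hj
    split_ifs at hj with hx
    · obtain hj | ⟨rfl, -⟩ | ⟨w, -, i, hi, rfl⟩ := PhaseRecord.pos_of_update hj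
      · exact (ih hj).trans t.lt_succ_self
      · exact hst
      · exact Nat.succ_lt_succ (ih hi)
    · exact (ih hj).trans t.lt_succ_self

namespace ElectionSetup

variable {T K : ℕ} (h : ElectionSetup L U awake T K)
include h

omit [L.LocallyFinite] in
theorem reachable : ∀ x ∈ U, ∀ y ∈ U, L.Reachable x y := fun x hx y hy =>
  SimpleGraph.edist_ne_top_iff_reachable.1
    ((h.edist_le x hx y hy).trans_lt (ENat.natCast_lt_top K)).ne

omit [L.LocallyFinite] in
theorem mem_awake (ht : T ≤ t) {x : ℕ} (hx : x ∈ U) : x ∈ awake t :=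
  h.awake_mono ht (h.subset_awake hx)

theorem mem_of_mem_insert_neighborFinset {x w : ℕ} (hx : x ∈ U)
    (hw : w ∈ insert x (L.neighborFinset x)) : w ∈ U := by
  obtain rfl | hw := Finset.mem_insert.1 hw
  · exact hx
  · exact mem_of_adj_of_support_subset h.support_subset ((L.mem_neighborFinset x w).1 hw).symm

theorem pos_ne_none_of_walk {x y : ℕ} (w : L.Walk x y) (ht : T ≤ t)
    (hx : (recordRun L awake t x p).pos ≠ none) :
    (recordRun L awake (t + w.length) y p).pos ≠ none := by
  induction w generalizing t with
  | nil => exact hx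
  | @cons x z y hxz w ih =>
    rw [SimpleGraph.Walk.length_cons, add_comm w.length, ← add_assoc]
    refine ih (ht.trans t.le_succ) ?_
    have hz : z ∈ U := mem_of_adj_of_support_subset h.support_subset hxz.symm
    rw [recordRun_succ_of_mem (h.mem_awake ht hz)]
    exact PhaseRecord.pos_update_ne_none
      (Or.inr ⟨x, (L.mem_neighborFinset z x).2 hxz.symm, hx⟩)

theorem kingdomsFormed {s x : ℕ} (hs : ∀ x, (recordRun L awake s x p).pos = none)
    (hx : (recordRun L awake t x p).pos ≠ none) (ht : T ≤ t) :
    KingdomsFormed L U awake p (t + K - (s + 1)) (t + K) := fun y hy => by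
  obtain ⟨i, hi⟩ := Option.ne_none_iff_exists'.1 hx
  obtain ⟨w, hw⟩ := exists_walk_length_le_of_edist_le
    (h.edist_le x ((ElectionInvariant.recordRun h.awake_subset t).mem hi) y hy)
  obtain ⟨j, hj⟩ := Option.ne_none_iff_exists'.1 <| ne_none_of_forall_eq_some
    (recordRun_extends (Nat.add_le_add_left hw t) y p).pos (h.pos_ne_none_of_walk w ht hx)
  exact ⟨j, hj, by have := add_depth_lt hs hj; lia⟩

/-- The results of a convergecast move up the trees by one level in each round. -/
theorem convergecast (hK : KingdomsFormed L U awake p d t) {Q : ℕ → ℕ → Prop}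
    (hQ : ∀ s ≥ t, ∀ x ∈ U, (∀ w, L.Adj x w →
      ((recordRun L awake s w p).pos).map Position.parent = some x → Q s w) → Q (s + 1) x) :
    ∀ x ∈ U, Q (t + (d + 1)) x := by
  have hQ_depth (m x : ℕ) (hx : x ∈ U) (j : Position)
      (hj : (recordRun L awake (t + m) x p).pos = some j) (hd : d < j.depth + m) :
      Q (t + m) x := by
    induction m generalizing x j with
    | zero =>
      obtain ⟨i, hi, hid⟩ := hK x hx
      obtain rfl := Option.some_injective _ (hi.symm.trans hj)
      exact absurd hd hid.not_gt
    | succ m ih =>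
      refine hQ (t + m) (Nat.le_add_right t m) x hx fun w hxw hparent => ?_
      obtain ⟨i, hi, hix⟩ := Option.map_eq_some_iff.1 hparent
      refine ih w (mem_of_adj_of_support_subset h.support_subset hxw.symm) i hi ?_
      obtain ⟨rfl, -⟩ | ⟨v, -, j', hj', rfl⟩ :=
        (ElectionInvariant.recordRun h.awake_subset (t + m)).pos hi
      · exact absurd hix hxw.ne'
      · obtain rfl : v = x := hix
        obtain rfl := Option.some_injective _
          (hj.symm.trans ((recordRun_extends_succ _ v p).pos hj'))
        change d < j.depth + 1 + m
        lia
  intro x hx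
  obtain ⟨j, hj, -⟩ := hK.mono (Nat.le_add_right t (d + 1)) x hx
  exact hQ_depth (d + 1) x hx j hj (by lia)

variable (hK : KingdomsFormed L U awake p d t) (ht : T ≤ t)
include hK ht

theorem found_ne_none : ∀ x ∈ U, (recordRun L awake (t + (d + 1)) x p).found ≠ none := by
  refine h.convergecast hK (Q := fun s x => (recordRun L awake s x p).found ≠ none)
    fun s hs x hx hchild => ?_
  rw [recordRun_succ_of_mem (h.mem_awake (ht.trans hs) hx), PhaseRecord.update, ne_eq,
    Option.or_eq_none_iff, not_and]
  refine fun _ => gather_ne_none (fun w hw => ?_) fun w hw =>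
    hchild w ((L.mem_neighborFinset x w).1 hw)
  obtain ⟨j, hj, -⟩ := hK.mono hs w (h.mem_of_mem_insert_neighborFinset hx hw)
  rw [PhaseRecord.root, hj]
  exact Option.some_ne_none _

theorem reported_ne_none (hknown : ∀ x ∈ U, (recordRun L awake t x p).known ≠ none) :
    ∀ x ∈ U, (recordRun L awake (t + (d + 1)) x p).reported ≠ none := by
  refine h.convergecast hK (Q := fun s x => (recordRun L awake s x p).reported ≠ none)
    fun s hs x hx hchild => ?_
  rw [recordRun_succ_of_mem (h.mem_awake (ht.trans hs) hx), PhaseRecord.update, ne_eq,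
    Option.or_eq_none_iff, not_and]
  refine fun _ => gather_ne_none (fun w hw => ?_) fun w hw =>
    hchild w ((L.mem_neighborFinset x w).1 hw)
  exact ne_none_of_forall_eq_some (recordRun_extends hs w p).known
    (hknown w (h.mem_of_mem_insert_neighborFinset hx hw))

theorem known_ne_none (hfound : ∀ x ∈ U, (recordRun L awake t x p).found ≠ none)
    (hwins : ∀ x ∈ U, ¬ Wins x (recordRun L awake t x)) :
    ∀ x ∈ U, (recordRun L awake (t + (d + 1)) x p).known ≠ none := by
  have known_of_depth (m x : ℕ) (hx : x ∈ U) (j : Position)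
      (hj : (recordRun L awake t x p).pos = some j) (hm : j.depth < m) :
      (recordRun L awake (t + m) x p).known ≠ none := by
    induction m generalizing x j with
    | zero => exact absurd hm (Nat.not_lt_zero _)
    | succ m ih =>
      have hext := recordRun_extends (L := L) (awake := awake) (Nat.le_add_right t m) x p
      rw [← add_assoc, recordRun_succ_of_mem (h.mem_awake (ht.trans (Nat.le_add_right t m)) hx)]
      refine PhaseRecord.known_update_ne_none (hext.pos hj) ?_
      obtain ⟨rfl, -⟩ | ⟨w, hw, i, hi, rfl⟩ :=
        (ElectionInvariant.recordRun h.awake_subset t).pos hj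
      · obtain ⟨S, hS⟩ := Option.ne_none_iff_exists'.1 (hfound x hx)
        exact Or.inl ⟨rfl, S, hext.found hS, fun hSx => hwins x hx ⟨p, hj, hSx ▸ hS⟩⟩
      · exact Or.inr ⟨Nat.succ_ne_zero _, (L.mem_neighborFinset x w).2 hw,
          ih w (mem_of_adj_of_support_subset h.support_subset hw.symm) i hi
            (Nat.lt_of_succ_lt_succ hm)⟩
  intro x hx
  obtain ⟨j, hj, hd⟩ := hK x hx
  exact known_of_depth (d + 1) x hx j hj (Nat.lt_succ_of_le hd)

/-- The largest root of the phase qualifies for the next one. -/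
theorem exists_pos_succ_ne_none (hU : U.Nonempty)
    (hreported : ∀ x ∈ U, (recordRun L awake t x p).reported ≠ none) :
    ∃ x, (recordRun L awake (t + 1) x (p + 1)).pos ≠ none := by
  have inv := ElectionInvariant.recordRun (L := L) h.awake_subset t
  obtain ⟨x, hx⟩ := hU
  obtain ⟨j, hj, -⟩ := hK x hx
  have hroots : (phaseRoots U (recordRun L awake t) p).Nonempty :=
    ⟨_, inv.mem_phaseRoots.2 (inv.pos_root (PhaseRecord.root_eq_some_iff.2 ⟨j, hj, rfl⟩))⟩
  obtain ⟨m, hm, hmax⟩ := Finset.exists_max_image _ id hroots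
  have hpos := inv.mem_phaseRoots.1 hm
  obtain ⟨S, hS⟩ := Option.ne_none_iff_exists'.1 (hreported m (inv.mem hpos))
  refine ⟨m, ?_⟩
  rw [recordRun_succ_of_mem (h.mem_awake ht (inv.mem hpos))]
  exact PhaseRecord.pos_update_ne_none <| Or.inl ⟨hpos, S, hS, fun x hx =>
    hmax x (inv.mem_phaseRoots.2 (inv.pos_of_mem_reported hS hx))⟩

theorem exists_wins_or_pos_succ_ne_none (hU : U.Nonempty) :
    (∃ x ∈ U, Wins x (recordRun L awake (t + (3 * d + 4)) x)) ∨
      ∃ x, (recordRun L awake (t + (3 * d + 4)) x (p + 1)).pos ≠ none := by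
  by_cases! hwins : ∃ x ∈ U, Wins x (recordRun L awake (t + (d + 1)) x)
  · exact Or.inl <| hwins.imp fun x => And.imp_right fun hx =>
      hx.mono (recordRun_extends (by lia) x)
  right
  have ht₁ := Nat.le_add_right t (d + 1)
  have ht₂ := ht₁.trans (Nat.le_add_right (t + (d + 1)) (d + 1))
  have ht₃ := ht₂.trans (Nat.le_add_right (t + (d + 1) + (d + 1)) (d + 1))
  have hfound := h.found_ne_none hK ht
  have hknown := h.known_ne_none (hK.mono ht₁) (ht.trans ht₁) hfound hwins
  have hreported := h.reported_ne_none (hK.mono ht₂) (ht.trans ht₂) hknown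
  rw [show t + (3 * d + 4) = t + (d + 1) + (d + 1) + (d + 1) + 1 by ring]
  exact h.exists_pos_succ_ne_none (hK.mono ht₃) (ht.trans ht₃) hU hreported

omit hK ht

theorem exists_wins_or_pos_ne_none (hU : U.Nonempty) (p : ℕ) :
    (∃ x ∈ U, Wins x (recordRun L awake (4 * T + 1 + p * (4 * K + 4)) x)) ∨
      ∃ x, (recordRun L awake (4 * T + 1 + p * (4 * K + 4)) x p).pos ≠ none := by
  classical
  induction p with
  | zero =>
    obtain ⟨x, hx⟩ := hU
    rw [zero_mul, add_zero]
    refine Or.inr ⟨x, ?_⟩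
    rw [recordRun_succ_of_mem (h.mem_awake (by lia) hx)]
    exact PhaseRecord.pos_update_ne_none (Or.inl trivial)
  | succ p ih =>
    obtain ⟨x, hx, hwins⟩ | hpos := ih
    · exact Or.inl ⟨x, hx, hwins.mono (recordRun_extends (by gcongr; lia) x)⟩
    have hex : ∃ t x, (recordRun L awake t x p).pos ≠ none := ⟨_, hpos⟩
    obtain ⟨y, hy⟩ := Nat.find_spec hex
    obtain ⟨s, hs⟩ : ∃ s, Nat.find hex = s + 1 :=
      Nat.exists_eq_succ_of_ne_zero fun hzero => by
        rw [hzero] at hy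
        exact hy rfl
    have hs_none (x : ℕ) : (recordRun L awake s x p).pos = none := by
      by_contra hx
      exact Nat.find_min hex (hs ▸ s.lt_succ_self) ⟨x, hx⟩
    have hsle : s + 1 ≤ 4 * T + 1 + p * (4 * K + 4) := hs ▸ Nat.find_min' hex hpos
    rw [hs] at hy
    have hK := h.kingdomsFormed hs_none (ne_none_of_forall_eq_some
      (recordRun_extends (le_max_left (s + 1) T) y p).pos hy) (le_max_right _ _)
    have htime : max (s + 1) T + K + (3 * (max (s + 1) T + K - (s + 1)) + 4) ≤
        4 * T + 1 + (p + 1) * (4 * K + 4) := by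
      rw [add_one_mul]
      lia
    refine (h.exists_wins_or_pos_succ_ne_none hK (by lia) hU).imp ?_ ?_
    · exact Exists.imp fun x => And.imp_right fun hx => hx.mono (recordRun_extends htime x)
    · exact Exists.imp fun x => ne_none_of_forall_eq_some (recordRun_extends htime x (p + 1)).pos

theorem exists_wins (hU : U.Nonempty) : ∃ x ∈ U,
    Wins x (recordRun L awake (4 * T + 1 + (Nat.log 2 U.card + 1) * (4 * K + 4)) x) := by
  refine (h.exists_wins_or_pos_ne_none hU (Nat.log 2 U.card + 1)).resolve_right ?_
  rintro ⟨x, hx⟩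
  obtain ⟨j, hj⟩ := Option.ne_none_iff_exists'.1 hx
  exact Nat.not_succ_le_self _
    ((ElectionInvariant.recordRun h.awake_subset _).phase_le_log h.reachable hj)

theorem mem_awake_of_pos_ne_none {x : ℕ} (hx : (recordRun L awake t x p).pos ≠ none) :
    x ∈ awake t := by
  induction t with
  | zero => exact absurd rfl hx
  | succ t ih =>
    refine h.awake_mono t.le_succ ?_
    by_contra hawake
    rw [recordRun, if_neg hawake] at hx
    exact hawake (ih hx)

theorem mem_awake_of_wins {v x : ℕ} (hv : Wins v (recordRun L awake t v)) (hx : x ∈ U) :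
    x ∈ awake t := by
  obtain ⟨p, hpos, hfound⟩ := hv
  obtain ⟨j, hj, -⟩ := PhaseRecord.root_eq_some_iff.1 <|
    (ElectionInvariant.recordRun h.awake_subset t).root_eq_of_found h.reachable hpos hfound hx
  exact h.mem_awake_of_pos_ne_none (p := p) (hj ▸ Option.some_ne_none j)

theorem wins_unique {t' v w : ℕ} (hv : Wins v (recordRun L awake t v))
    (hw : Wins w (recordRun L awake t' w)) : v = w :=
  (ElectionInvariant.recordRun h.awake_subset (max t t')).wins_unique h.reachable
    (hv.mono (recordRun_extends (le_max_left t t') v))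
    (hw.mono (recordRun_extends (le_max_right t t') w))

end ElectionSetup

end election

/-! ### The algorithm -/

/-- A message of the leader election: the rumors of the spanner construction, the records of the
sender, and the identifier of the leader, each of them optional. -/
structure LeaderMsg where
  rumors : Option (Finset ℕ)
  records : Option (ℕ → PhaseRecord)
  leader : Option ℕ

/-- The state of a node during the leader election: its state in the spanner construction, its
`records`, the records that it `published` last to its neighbors in the spanner, the `copies` of the
records that its neighbors published last, the leader as soon as it is known, and the output. -/
structure LeaderState where
  spanner : SpannerState
  records : ℕ → PhaseRecord
  published : ℕ → PhaseRecord
  copies : ℕ → ℕ → PhaseRecord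
  leader : Option ℕ
  output : Option ℕ

namespace LeaderState

/-- The initial state of the node `x` with neighbors `N`.  A node without neighbors elects itself
at once. -/
def init (x : ℕ) (N : Finset ℕ) : LeaderState where
  spanner := .init x N
  records := fun _ => .empty
  published := fun _ => .empty
  copies := fun _ _ => .empty
  leader := if N = ∅ then some x else none
  output := if N = ∅ then some x else none

open Classical in
/-- The contents of the message to `y`. -/
noncomputable def message (s : LeaderState) (y : ℕ) : LeaderMsg where
  rumors := s.spanner.send y
  records := if s.records ≠ s.published ∧ y ∈ s.spanner.links then some s.records else none
  leader := if y ∈ s.spanner.links then s.leader else none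

open Classical in
/-- The message to `y`, unless its contents are empty. -/
noncomputable def send (s : LeaderState) (y : ℕ) : Option LeaderMsg :=
  if s.message y = ⟨none, none, none⟩ then none else some (s.message y)

/-- The copies at the end of the current round. -/
def newCopies (s : LeaderState) (inbox : ℕ → Option LeaderMsg) (y : ℕ) : ℕ → PhaseRecord :=
  ((inbox y).bind LeaderMsg.records).getD (s.copies y)

/-- The records at the end of the current round.  A node takes part in the election as soon as it
knows all its spanner edges. -/
noncomputable def newRecords (s : LeaderState) (inbox : ℕ → Option LeaderMsg) (p : ℕ) :
    PhaseRecord :=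
  if s.spanner.unknown = ∅ then
    .update s.spanner.id s.spanner.links (Qualifies s.spanner.id s.records p) fun w =>
      Function.update (s.newCopies inbox) s.spanner.id s.records w p
  else s.records p

open Classical in
/-- The leader at the end of the current round: a node learns the leader by winning the election or
from a neighbor in the spanner. -/
noncomputable def newLeader (s : LeaderState) (inbox : ℕ → Option LeaderMsg) : Option ℕ :=
  s.leader.or <| if Wins s.spanner.id (s.newRecords inbox) then some s.spanner.id else
    (leastId (s.spanner.links.filter fun y => (inbox y).bind LeaderMsg.leader ≠ none)).bind fun y =>
      (inbox y).bind LeaderMsg.leader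

/-- The transition of a node.  It terminates in the round in which it announces the leader. -/
noncomputable def receive (s : LeaderState) (inbox : ℕ → Option LeaderMsg) : LeaderState where
  spanner := s.spanner.receive fun y => (inbox y).bind LeaderMsg.rumors
  records := s.newRecords inbox
  published := s.records
  copies := s.newCopies inbox
  leader := s.newLeader inbox
  output := s.leader

theorem send_bind {α : Type*} {f : LeaderMsg → Option α} (hf : f ⟨none, none, none⟩ = none)
    (s : LeaderState) (y : ℕ) : (s.send y).bind f = f (s.message y) := by
  rw [send]
  split_ifs with h
  · rw [h, hf, Option.bind_none]
  · exact Option.bind_some _ _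

theorem send_ne_none {s : LeaderState} {y : ℕ} (h : s.send y ≠ none) :
    s.spanner.send y ≠ none ∨
      (s.records ≠ s.published ∨ s.leader ≠ none) ∧ y ∈ s.spanner.links := by
  classical
  contrapose! h
  obtain ⟨hrumors, hlinks⟩ := h
  refine if_pos ?_
  by_cases hy : y ∈ s.spanner.links
  · have hquiet : ¬ (s.records ≠ s.published ∨ s.leader ≠ none) := fun hor => hlinks hor hy
    rw [not_or, not_not, not_not] at hquiet
    simp only [message, hrumors, hquiet, ne_eq, not_true_eq_false, false_and, if_false, ite_self]
  · simp only [message, hrumors, hy, and_false, if_false]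

theorem newLeader_eq_some {s : LeaderState} {inbox : ℕ → Option LeaderMsg} {v : ℕ}
    (h : s.newLeader inbox = some v) : s.leader = some v ∨
      v = s.spanner.id ∧ Wins v (s.newRecords inbox) ∨
      ∃ y ∈ s.spanner.links, (inbox y).bind LeaderMsg.leader = some v := by
  classical
  refine (Option.or_eq_some_iff.1 h).imp_right fun ⟨_, h⟩ => ?_
  split_ifs at h with hwins
  · obtain rfl := Option.some_injective _ h
    exact Or.inl ⟨rfl, hwins⟩
  · obtain ⟨y, hy, hv⟩ := Option.bind_eq_some_iff.1 h
    exact Or.inr ⟨y, (Finset.mem_filter.1 (mem_of_leastId_eq_some hy)).1, hv⟩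

theorem newLeader_ne_none {s : LeaderState} {inbox : ℕ → Option LeaderMsg}
    (h : Wins s.spanner.id (s.newRecords inbox) ∨
      ∃ y ∈ s.spanner.links, (inbox y).bind LeaderMsg.leader ≠ none) :
    s.newLeader inbox ≠ none := by
  classical
  rw [newLeader, ne_eq, Option.or_eq_none_iff, not_and]
  intro _
  by_cases hwins : Wins s.spanner.id (s.newRecords inbox)
  · rw [if_pos hwins]
    exact Option.some_ne_none _
  · rw [if_neg hwins]
    obtain ⟨y, hy⟩ := exists_leastId_eq_some <| (h.resolve_left hwins).imp fun y hy =>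
      (Finset.mem_filter (p := fun y => (inbox y).bind LeaderMsg.leader ≠ none)).2 hy
    rw [hy, Option.bind_some]
    exact (Finset.mem_filter.1 (mem_of_leastId_eq_some hy)).2

end LeaderState

/-- The leader election algorithm: the construction of a sparse spanner, the election of a leader on
the spanner, and the announcement of the leader along the spanner. -/
noncomputable def leaderElection : KT1LocalAlgorithm ℕ where
  State := LeaderState
  Msg := LeaderMsg
  init := LeaderState.init
  send := LeaderState.send
  receive := LeaderState.receive
  output := LeaderState.output

theorem sum_card_filter_and_adj_le {V : Type*} (G : SimpleGraph V) [G.LocallyFinite]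
    [DecidableRel G.Adj] (U : Finset V) (P : ℕ → V → Prop) [∀ r, DecidablePred (P r)] {m t : ℕ}
    (hP : ∀ x ∈ U, ((Finset.range t).filter fun r => P r x).card ≤ m) :
    ∑ r ∈ Finset.range t, ((U ×ˢ U).filter fun p => P r p.1 ∧ G.Adj p.1 p.2).card ≤
      m * ∑ x ∈ U, G.degree x := by
  have hround (r : ℕ) : ((U ×ˢ U).filter fun p => P r p.1 ∧ G.Adj p.1 p.2).card ≤
      ∑ x ∈ U, if P r x then G.degree x else 0 := by
    simp only [Finset.card_filter, Finset.sum_product]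
    refine Finset.sum_le_sum fun x _ => ?_
    rw [← Finset.card_filter]
    split_ifs with hx
    · exact Finset.card_le_card fun y hy =>
        (G.mem_neighborFinset x y).2 (Finset.mem_filter.1 hy).2.2
    · simp [hx]
  calc ∑ r ∈ Finset.range t, ((U ×ˢ U).filter fun p => P r p.1 ∧ G.Adj p.1 p.2).card
      ≤ ∑ r ∈ Finset.range t, ∑ x ∈ U, if P r x then G.degree x else 0 :=
        Finset.sum_le_sum fun r _ => hround r
    _ = ∑ x ∈ U, ((Finset.range t).filter fun r => P r x).card * G.degree x := by
        rw [Finset.sum_comm]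
        refine Finset.sum_congr rfl fun x _ => ?_
        rw [← Finset.sum_filter, Finset.sum_const, smul_eq_mul]
    _ ≤ m * ∑ x ∈ U, G.degree x := by
        rw [Finset.mul_sum]
        exact Finset.sum_le_sum fun x hx => Nat.mul_le_mul_right _ (hP x hx)

section leaderRun

variable (H : SimpleGraph ℕ) [H.LocallyFinite]

/-- The messages that `x` receives in the configuration `s`, if terminated nodes go on. -/
noncomputable def leaderInbox (s : ℕ → LeaderState) (x y : ℕ) : Option LeaderMsg :=
  if y ∈ H.neighborFinset x then (s y).send x else none

/-- The run of the leader election on `H`, where terminated nodes go on.  As they have nothing new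
to say, this does not affect the nodes that have not yet terminated. -/
noncomputable def leaderRun : ℕ → ℕ → LeaderState
  | 0, x => .init x (H.neighborFinset x)
  | t + 1, x => (leaderRun t x).receive (leaderInbox H (leaderRun t) x)

/-- The nodes in `U` that know all their spanner edges in round `t`. -/
def awakeNodes (U : Finset ℕ) (t : ℕ) : Set ℕ := {x | x ∈ U ∧ (spannerRun H t x).unknown = ∅}

/-- The records of the election on the spanner of `H`. -/
noncomputable def electionRun (U : Finset ℕ) : ℕ → ℕ → ℕ → PhaseRecord :=
  recordRun (spanner H) (awakeNodes H U)

variable {H}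

theorem spanner_leaderRun (t x : ℕ) : (leaderRun H t x).spanner = spannerRun H t x := by
  induction t generalizing x with
  | zero => rfl
  | succ t ih =>
    change (leaderRun H t x).spanner.receive _ = (spannerRun H t x).receive _
    rw [ih]
    congr 1
    funext y
    rw [leaderInbox, spannerInbox, apply_ite (Option.bind · LeaderMsg.rumors),
      LeaderState.send_bind rfl, LeaderState.message, ih, Option.bind_none]

theorem leaderInbox_bind {α : Type*} {f : LeaderMsg → Option α}
    (hf : f ⟨none, none, none⟩ = none) {t x y : ℕ} (h : (spanner H).Adj x y) :
    (leaderInbox H (leaderRun H t) x y).bind f = f ((leaderRun H t y).message x) := by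
  rw [leaderInbox, if_pos ((H.mem_neighborFinset x y).2 (spanner_le h)),
    LeaderState.send_bind hf]

theorem leader_leaderRun_mono {s t x v : ℕ} (hst : s ≤ t)
    (h : (leaderRun H s x).leader = some v) : (leaderRun H t x).leader = some v := by
  induction t, hst using Nat.le_induction with
  | base => exact h
  | succ t _ ih => exact Option.or_eq_some_iff.2 (Or.inl ih)

theorem card_leader_leaderRun_ne_le (x t : ℕ) : ((Finset.range t).filter fun r =>
    (leaderRun H r x).leader ≠ (leaderRun H (r - 1) x).leader).card ≤ 1 := by
  refine (card_filter_ne_le (fun r => (leaderRun H r x).leader) (fun o => o.isSome.toNat)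
    (fun r hne => ?_) t).trans (Bool.toNat_le _)
  obtain hnone | ⟨v, hv⟩ := (leaderRun H r x).leader.eq_none_or_eq_some
  · rw [hnone] at hne ⊢
    obtain ⟨v, hv⟩ := Option.ne_none_iff_exists'.1 hne
    rw [hv]
    exact Nat.zero_lt_one
  · exact absurd ((leader_leaderRun_mono r.le_succ hv).trans hv.symm) hne

theorem leader_of_output_leaderRun {t x v : ℕ} (h : (leaderRun H t x).output = some v) :
    (leaderRun H t x).leader = some v := by
  cases t with
  | zero => exact h
  | succ t => exact leader_leaderRun_mono t.le_succ h

theorem spanner_adj_of_send_leaderRun_ne_none {t x y : ℕ}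
    (h : (leaderRun H t x).send y ≠ none) : (spanner H).Adj x y := by
  have hsend := LeaderState.send_ne_none h
  rw [spanner_leaderRun] at hsend
  obtain hsend | ⟨-, hlinks⟩ := hsend
  · exact spanner_adj_of_send_ne_none hsend
  · exact ((spanner H).mem_neighborFinset x y).1
      (links_subset_neighborFinset_spanner t x hlinks)

variable {U : Finset ℕ}

theorem awakeNodes_mono : Monotone (awakeNodes H U) := fun _ _ hst _ hx =>
  ⟨hx.1, unknown_spannerRun_eq_empty_of_le hst hx.2⟩

theorem links_leaderRun_of_mem_awakeNodes {t x : ℕ} (h : x ∈ awakeNodes H U t) :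
    (leaderRun H t x).spanner.links = (spanner H).neighborFinset x := by
  rw [spanner_leaderRun, links_eq_neighborFinset_spanner h.2]

theorem electionSetup (hU : H.support ⊆ U) {D : ℕ} (hD : ∀ x ∈ U, ∀ y ∈ U, H.edist x y ≤ D) :
    ElectionSetup (spanner H) U (awakeNodes H U) (iterStart (Nat.log 2 U.card))
      (2 * Nat.log 2 U.card * D) where
  support_subset := support_spanner_subset hU
  edist_le x hx y hy := by
    obtain ⟨p, hp⟩ := exists_walk_length_le_of_edist_le (hD x hx y hy)
    exact (edist_le_mul_length (fun _ _ => edist_spanner_le_of_adj hU) p).trans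
      (Nat.cast_le.2 (Nat.mul_le_mul_left _ hp))
  awake_mono := awakeNodes_mono
  awake_subset _ _ hx := hx.1
  subset_awake _ hx := ⟨hx, unknown_spannerRun_eq_empty hU le_rfl⟩

theorem mem_awakeNodes_of_electionRun_ne {t x : ℕ}
    (h : electionRun H U t x ≠ electionRun H U (t - 1) x) : x ∈ awakeNodes H U t := by
  cases t with
  | zero => exact absurd rfl h
  | succ t =>
    refine awakeNodes_mono t.le_succ ?_
    by_contra hx
    refine h (funext fun p => ?_)
    rw [electionRun, recordRun, if_neg hx, Nat.add_sub_cancel]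

/-- The records in the state `s` of the node `x` after `t` rounds: the current ones are those of
the election, and the published ones and the copies are those of the previous round. -/
structure RecordsInvariant (H : SimpleGraph ℕ) [H.LocallyFinite] (U : Finset ℕ) (t x : ℕ)
    (s : LeaderState) : Prop where
  records : s.records = electionRun H U t x
  published : s.published = electionRun H U (t - 1) x
  copies : ∀ y, (spanner H).Adj x y → s.copies y = electionRun H U (t - 1) y

theorem newCopies_leaderRun {t x y : ℕ}
    (hx : RecordsInvariant H U t x (leaderRun H t x))
    (hy : RecordsInvariant H U t y (leaderRun H t y)) (hxy : (spanner H).Adj x y) :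
    (leaderRun H t x).newCopies (leaderInbox H (leaderRun H t) x) y = electionRun H U t y := by
  rw [LeaderState.newCopies, leaderInbox_bind rfl hxy, LeaderState.message, hy.records,
    hy.published, hx.copies y hxy]
  by_cases hne : electionRun H U t y = electionRun H U (t - 1) y
  · rw [if_neg fun h => h.1 hne, Option.getD_none, hne]
  · have hlinks : x ∈ (leaderRun H t y).spanner.links := by
      rw [links_leaderRun_of_mem_awakeNodes (mem_awakeNodes_of_electionRun_ne hne)]
      exact ((spanner H).mem_neighborFinset y x).2 hxy.symm
    rw [if_pos ⟨hne, hlinks⟩, Option.getD_some]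

theorem newRecords_leaderRun {t x : ℕ} (hx : x ∈ U)
    (hrecords : (leaderRun H t x).records = electionRun H U t x)
    (hcopies : ∀ y, (spanner H).Adj x y →
      (leaderRun H t x).newCopies (leaderInbox H (leaderRun H t) x) y = electionRun H U t y) :
    (leaderRun H t x).newRecords (leaderInbox H (leaderRun H t) x) =
      electionRun H U (t + 1) x := by
  funext p
  rw [LeaderState.newRecords, hrecords, spanner_leaderRun, id_spannerRun]
  by_cases hknown : (spannerRun H t x).unknown = ∅
  · have hawake : x ∈ awakeNodes H U t := ⟨hx, hknown⟩
    rw [if_pos hknown, links_eq_neighborFinset_spanner hknown, electionRun,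
      recordRun_succ_of_mem hawake]
    refine PhaseRecord.update_congr fun w hw => ?_
    obtain rfl | hw := Finset.mem_insert.1 hw
    · rw [Function.update_self]
    · rw [SimpleGraph.mem_neighborFinset] at hw
      rw [Function.update_of_ne hw.ne', hcopies w hw, electionRun]
  · rw [if_neg hknown, electionRun, recordRun, if_neg fun hawake => hknown hawake.2]

theorem recordsInvariant_leaderRun (hU : H.support ⊆ U) (t : ℕ) :
    ∀ x ∈ U, RecordsInvariant H U t x (leaderRun H t x) := by
  induction t with
  | zero => exact fun x _ => ⟨rfl, rfl, fun _ _ => rfl⟩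
  | succ t ih =>
    intro x hx
    have hcopies (y : ℕ) (hxy : (spanner H).Adj x y) :
        (leaderRun H t x).newCopies (leaderInbox H (leaderRun H t) x) y = electionRun H U t y :=
      newCopies_leaderRun (ih x hx)
        (ih y (mem_of_adj_of_support_subset (support_spanner_subset hU) hxy.symm)) hxy
    exact ⟨newRecords_leaderRun hx (ih x hx).records hcopies, (ih x hx).records, hcopies⟩

section leader

variable (hU : H.support = U)
include hU

theorem leader_leaderRun_zero {x : ℕ} (hx : x ∈ U) : (leaderRun H 0 x).leader = none := by
  obtain ⟨y, hxy⟩ := H.mem_support.1 (hU ▸ Finset.mem_coe.2 hx)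
  exact if_neg (Finset.ne_empty_of_mem ((H.mem_neighborFinset x y).2 hxy))

theorem wins_of_leader {t x v : ℕ} (hx : x ∈ U) (h : (leaderRun H t x).leader = some v) :
    Wins v (electionRun H U t v) := by
  induction t generalizing x with
  | zero => exact absurd ((leader_leaderRun_zero hU hx).symm.trans h) (Option.some_ne_none v).symm
  | succ t ih =>
    obtain h | ⟨rfl, hwins⟩ | ⟨y, hy, h⟩ := LeaderState.newLeader_eq_some h
    · exact (ih hx h).mono (recordRun_extends_succ t v)
    · rw [spanner_leaderRun, id_spannerRun] at hwins ⊢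
      rwa [← (recordsInvariant_leaderRun hU.le (t + 1) x hx).records]
    · rw [spanner_leaderRun] at hy
      have hxy := ((spanner H).mem_neighborFinset x y).1
        (links_subset_neighborFinset_spanner t x hy)
      rw [leaderInbox_bind rfl hxy] at h
      exact (ih (mem_of_adj_of_support_subset (support_spanner_subset hU.le) hxy.symm)
        (Option.ite_none_right_eq_some.1 h).2).mono (recordRun_extends_succ t v)

theorem leader_ne_none_of_wins {t x : ℕ} (hx : x ∈ U)
    (h : Wins x (electionRun H U (t + 1) x)) : (leaderRun H (t + 1) x).leader ≠ none := by
  refine LeaderState.newLeader_ne_none (Or.inl ?_)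
  rw [spanner_leaderRun, id_spannerRun]
  rwa [← (recordsInvariant_leaderRun hU.le (t + 1) x hx).records] at h

variable {T K : ℕ} (hs : ElectionSetup (spanner H) U (awakeNodes H U) T K)
include hs

theorem leader_ne_none_of_adj {t x y : ℕ} (hxy : (spanner H).Adj x y)
    (h : (leaderRun H t x).leader ≠ none) : (leaderRun H (t + 1) y).leader ≠ none := by
  have hx := mem_of_adj_of_support_subset hs.support_subset hxy
  have hy := mem_of_adj_of_support_subset hs.support_subset hxy.symm
  obtain ⟨v, hv⟩ := Option.ne_none_iff_exists'.1 h
  have hlinks {z : ℕ} (hz : z ∈ U) :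
      (leaderRun H t z).spanner.links = (spanner H).neighborFinset z :=
    links_leaderRun_of_mem_awakeNodes (hs.mem_awake_of_wins (wins_of_leader hU hx hv) hz)
  refine LeaderState.newLeader_ne_none (Or.inr ⟨x, ?_, ?_⟩)
  · rw [hlinks hy]
    exact ((spanner H).mem_neighborFinset y x).2 hxy.symm
  · rw [leaderInbox_bind rfl hxy.symm, LeaderState.message, hlinks hx,
      if_pos (((spanner H).mem_neighborFinset x y).2 hxy)]
    exact h

theorem leader_ne_none_of_walk {t x y : ℕ} (w : (spanner H).Walk x y)
    (h : (leaderRun H t x).leader ≠ none) : (leaderRun H (t + w.length) y).leader ≠ none := by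
  induction w generalizing t with
  | nil => exact h
  | cons hxz w ih =>
    rw [SimpleGraph.Walk.length_cons, add_comm w.length, ← add_assoc]
    exact ih (leader_ne_none_of_adj hU hs hxz h)

theorem exists_output_leaderRun (hne : U.Nonempty) : ∃ l ∈ U, ∀ x ∈ U,
    (leaderRun H (4 * T + 1 + (Nat.log 2 U.card + 1) * (4 * K + 4) + K + 1) x).output = some l := by
  obtain ⟨l, hl, hwins⟩ := hs.exists_wins hne
  refine ⟨l, hl, fun x hx => ?_⟩
  obtain ⟨t, ht⟩ : ∃ t, 4 * T + 1 + (Nat.log 2 U.card + 1) * (4 * K + 4) = t + 1 :=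
    ⟨_, Nat.add_right_comm _ _ _⟩
  rw [ht] at hwins ⊢
  obtain ⟨w, hw⟩ := exists_walk_length_le_of_edist_le (hs.edist_le l hl x hx)
  obtain ⟨v, hv⟩ := Option.ne_none_iff_exists'.1 <|
    leader_ne_none_of_walk hU hs w (leader_ne_none_of_wins hU hl hwins)
  obtain rfl := hs.wins_unique (wins_of_leader hU hx hv) hwins
  exact leader_leaderRun_mono (Nat.add_le_add_left hw _) hv

/-- A node without a leader has only unterminated neighbors in the spanner, and other neighbors send
it nothing. -/
theorem inbox_leaderElection_eq {t x : ℕ} (hleader : (leaderRun H t x).leader = none)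
    {s : ℕ → leaderElection.State}
    (houtput : ∀ y, leaderElection.output (s y) = (leaderRun H t y).output)
    (hstate : ∀ y, (leaderRun H t y).output = none → s y = leaderRun H t y) :
    leaderElection.inbox H (.refl ℕ) s x = leaderInbox H (leaderRun H t) x := by
  rw [KT1LocalAlgorithm.inbox_refl]
  funext y
  rw [KT1LocalAlgorithm.sent, leaderInbox]
  by_cases hxy : H.Adj x y
  · rw [if_pos ((H.mem_neighborFinset x y).2 hxy)]
    by_cases hy : (leaderRun H t y).output = none
    · rw [if_pos ⟨hxy.symm, (houtput y).trans hy⟩, hstate y hy]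
      rfl
    · rw [if_neg fun h => hy ((houtput y).symm.trans h.2)]
      by_contra hsend
      have hyx := spanner_adj_of_send_leaderRun_ne_none (Ne.symm hsend)
      cases t with
      | zero =>
        exact hy (if_neg (Finset.ne_empty_of_mem ((H.mem_neighborFinset y x).2 hxy.symm)))
      | succ t => exact leader_ne_none_of_adj hU hs hyx hy hleader
  · rw [if_neg fun h => hxy h.1.symm, if_neg fun h => hxy ((H.mem_neighborFinset x y).1 h)]
    rfl

theorem idRun_leaderElection (t x : ℕ) :
    leaderElection.output (leaderElection.idRun H t x) = (leaderRun H t x).output ∧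
      ((leaderRun H t x).output = none → leaderElection.idRun H t x = leaderRun H t x) := by
  induction t generalizing x with
  | zero => exact ⟨rfl, fun _ => rfl⟩
  | succ t ih =>
    rw [KT1LocalAlgorithm.idRun, KT1LocalAlgorithm.step, (ih x).1]
    split_ifs with houtput
    · rw [(ih x).2 houtput]
      refine ⟨rfl, fun hleader => ?_⟩
      rw [inbox_leaderElection_eq hU hs hleader (fun y => (ih y).1) fun y => (ih y).2]
      rfl
    · obtain ⟨v, hv⟩ := Option.ne_none_iff_exists'.1 houtput
      have hsucc : (leaderRun H (t + 1) x).output = some v := leader_of_output_leaderRun hv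
      rw [hsucc, (ih x).1, hv]
      exact ⟨rfl, fun h => absurd h (Option.some_ne_none v)⟩

theorem of_sent_leaderElection_ne_none {t x y : ℕ} (hx : x ∈ U)
    (h : leaderElection.sent H (.refl ℕ) (leaderElection.idRun H t) x y ≠ none) :
    (spannerRun H t x).send y ≠ none ∨
      (electionRun H U t x ≠ electionRun H U (t - 1) x ∨
        (leaderRun H t x).leader ≠ (leaderRun H (t - 1) x).leader) ∧ (spanner H).Adj x y := by
  classical
  obtain ⟨⟨-, houtput⟩, hsend⟩ := ite_ne_right_iff.1 h
  rw [(idRun_leaderElection hU hs t x).1] at houtput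
  rw [(idRun_leaderElection hU hs t x).2 houtput] at hsend
  have hrec := recordsInvariant_leaderRun hU.le t x hx
  refine (LeaderState.send_ne_none hsend).imp (fun h => ?_) (And.imp (Or.imp (fun h => ?_)
    fun hleader h => ?_) fun _ => spanner_adj_of_send_leaderRun_ne_none hsend)
  · rwa [spanner_leaderRun] at h
  · rwa [hrec.records, hrec.published] at h
  · cases t with
    | zero => exact hleader (leader_leaderRun_zero hU hx)
    | succ t => exact hleader (h.trans houtput)

open Classical in
theorem sum_card_sent_leaderElection_le (t : ℕ) :
    ∑ r ∈ Finset.range t, ((U ×ˢ U).filter fun p =>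
      leaderElection.sent H (.refl ℕ) (leaderElection.idRun H r) p.1 p.2 ≠ none).card ≤
      iterStart (Nat.log 2 U.card) * U.card +
        (4 * (Nat.log 2 U.card + 1) + 1) * (2 * (U.card * Nat.log 2 U.card)) := by
  let Rumor (r : ℕ) (p : ℕ × ℕ) : Prop := (spannerRun H r p.1).send p.2 ≠ none
  let News (r x : ℕ) : Prop := electionRun H U r x ≠ electionRun H U (r - 1) x ∨
    (leaderRun H r x).leader ≠ (leaderRun H (r - 1) x).leader
  have hround (r : ℕ) : ((U ×ˢ U).filter fun p =>
      leaderElection.sent H (.refl ℕ) (leaderElection.idRun H r) p.1 p.2 ≠ none).card ≤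
      ((U ×ˢ U).filter (Rumor r)).card +
        ((U ×ˢ U).filter fun p => News r p.1 ∧ (spanner H).Adj p.1 p.2).card := by
    refine (Finset.card_le_card fun p hp => ?_).trans (Finset.card_union_le _ _)
    obtain ⟨hpU, hsent⟩ := Finset.mem_filter.1 hp
    rw [← Finset.filter_or, Finset.mem_filter]
    exact ⟨hpU, of_sent_leaderElection_ne_none hU hs (Finset.mem_product.1 hpU).1 hsent⟩
  have hnews (x : ℕ) (_ : x ∈ U) :
      ((Finset.range t).filter fun r => News r x).card ≤ 4 * (Nat.log 2 U.card + 1) + 1 := by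
    rw [Finset.filter_or]
    exact (Finset.card_union_le _ _).trans <| add_le_add
      (card_recordRun_ne_le hs.awake_subset hs.reachable x t) (card_leader_leaderRun_ne_le x t)
  refine (Finset.sum_le_sum fun r _ => hround r).trans ?_
  rw [Finset.sum_add_distrib]
  exact add_le_add (sum_card_send_spannerRun_le hU.le t) <|
    (sum_card_filter_and_adj_le (spanner H) U News hnews).trans <|
      Nat.mul_le_mul_left _ (sum_degree_spanner_le hU.le)

end leader

end leaderRun

theorem natLog_sq_le_four_mul_log_sq (n : ℕ) : (Nat.log 2 n : ℝ) ^ 2 ≤ 4 * Real.log n ^ 2 := by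
  have hle : (Nat.log 2 n : ℝ) ≤ 2 * Real.log n := by
    have hlog := Real.natLog_le_logb n 2
    have htwo : (1 / 2 : ℝ) ≤ Real.log 2 := by linarith [Real.log_two_gt_d9]
    rw [Real.logb, Nat.cast_ofNat, le_div_iff₀ (by linarith)] at hlog
    nlinarith [(Nat.log 2 n).cast_nonneg (α := ℝ)]
  calc (Nat.log 2 n : ℝ) ^ 2 ≤ (2 * Real.log n) ^ 2 :=
        pow_le_pow_left₀ (Nat.cast_nonneg _) hle 2
    _ = 4 * Real.log n ^ 2 := by ring

theorem cast_le_of_le_mul_natLog_sq {k c m n : ℕ} (h : k ≤ c * (m * Nat.log 2 n ^ 2)) :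
    (k : ℝ) ≤ 4 * c * (m * Real.log n ^ 2) :=
  calc (k : ℝ) ≤ c * (m * (Nat.log 2 n : ℝ) ^ 2) := by exact_mod_cast h
    _ ≤ c * (m * (4 * Real.log n ^ 2)) := by
        gcongr
        exact natLog_sq_le_four_mul_log_sq n
    _ = 4 * c * (m * Real.log n ^ 2) := by ring

theorem round_bound {I : ℕ} (hI : 1 ≤ I) (D : ℕ) :
    4 * iterStart I + 1 + (I + 1) * (4 * (2 * I * D) + 4) + 2 * I * D + 1 ≤
      20 * ((D + 1) * I ^ 2) := by
  obtain ⟨k, rfl⟩ := Nat.exists_eq_add_of_le hI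
  unfold iterStart
  nlinarith [Nat.zero_le (D * k), Nat.zero_le (D * k ^ 2), Nat.zero_le (k ^ 2)]

theorem message_bound {I : ℕ} (hI : 1 ≤ I) (n : ℕ) :
    iterStart I * n + (4 * (I + 1) + 1) * (2 * (n * I)) ≤ 20 * (n * I ^ 2) := by
  obtain ⟨k, rfl⟩ := Nat.exists_eq_add_of_le hI
  unfold iterStart
  nlinarith [Nat.zero_le (n * k), Nat.zero_le (n * k ^ 2)]

section network

variable {V : Type*} [Fintype V] (G : SimpleGraph V) (ids : V ↪ ℕ)

theorem electsLeaderBy_leaderElection_zero [Subsingleton V] (v : V) :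
    ElectsLeaderBy leaderElection G ids 0 := by
  refine ⟨v, fun w => ?_⟩
  obtain rfl := Subsingleton.elim v w
  refine if_pos ?_
  simp [Subsingleton.elim _ v]

theorem messageCount_eq_zero_of_subsingleton {Out : Type} (A : KT1LocalAlgorithm Out)
    [Subsingleton V] (t : ℕ) : A.messageCount G ids t = 0 := by
  refine Finset.sum_eq_zero fun r _ => Finset.card_eq_zero.2 (Finset.filter_eq_empty_iff.2 ?_)
  rintro ⟨v, w⟩ - hsent
  refine hsent (if_neg fun h => ?_)
  exact h.1.ne (Subsingleton.elim v w)

variable {G}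

theorem leaderElection_of_nontrivial [Nontrivial V] (hG : G.Connected) :
    (∃ T ≤ 20 * ((G.diam + 1) * Nat.log 2 (Fintype.card V) ^ 2),
      ElectsLeaderBy leaderElection G ids T) ∧
    ∀ t, leaderElection.messageCount G ids t ≤
      20 * (Fintype.card V * Nat.log 2 (Fintype.card V) ^ 2) := by
  classical
  set U : Finset ℕ := Finset.univ.map ids with hU_def
  have hcard : U.card = Fintype.card V := Finset.card_map ids
  have hmem (v : V) : ids v ∈ U := Finset.mem_map_of_mem ids (Finset.mem_univ v)
  have hI : 1 ≤ Nat.log 2 (Fintype.card V) := Nat.log_pos one_lt_two Fintype.one_lt_card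
  have hU : (G.map ids).support = U := by
    rw [support_map_embedding, hG.preconnected.support_eq_univ, hU_def, Finset.coe_map,
      Finset.coe_univ]
  have : (G.map ids).LocallyFinite := fun x =>
    (U.finite_toSet.subset fun _ h => mem_of_adj_of_support_subset hU.le h.symm).fintype
  have hs := electionSetup (D := G.diam) hU.le <| by
    simp only [hU_def, Finset.forall_mem_map, Finset.mem_univ, forall_const]
    exact edist_map_le_diam hG ids
  refine ⟨⟨_, round_bound hI G.diam, ?_⟩, fun t => ?_⟩
  · obtain ⟨l, hl, houtput⟩ := exists_output_leaderRun hU hs (Finset.univ_nonempty.map)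
    obtain ⟨l, -, rfl⟩ := Finset.mem_map.1 hl
    rw [hcard] at houtput
    refine ⟨l, fun v => ?_⟩
    rw [KT1LocalAlgorithm.run_eq_idRun_map]
    exact (idRun_leaderElection hU hs _ _).1.trans (houtput (ids v) (hmem v))
  · refine le_trans ?_ (message_bound hI (Fintype.card V))
    rw [← hcard]
    refine le_trans (le_of_eq ?_) (sum_card_sent_leaderElection_le hU hs t)
    exact Finset.sum_congr rfl fun r _ => leaderElection.messagesInRound_run G ids r

end network

theorem mainTheorem6 :
    ∃ (A : KT1LocalAlgorithm ℕ) (C : ℝ),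
      ∀ (V : Type*) [Fintype V] (G : SimpleGraph V) (ids : V ↪ ℕ), G.Connected →
        (∃ T : ℕ, ElectsLeaderBy A G ids T ∧
          (T : ℝ) ≤ C * ((G.diam : ℝ) * Real.log (Fintype.card V) ^ 2
            + Real.log (Fintype.card V) ^ 2)) ∧
        (∀ t : ℕ, (A.messageCount G ids t : ℝ) ≤
          C * ((Fintype.card V : ℝ) * Real.log (Fintype.card V) ^ 2)) := by
  refine ⟨leaderElection, 80, fun V _ G ids hG => ?_⟩
  rcases subsingleton_or_nontrivial V with _ | _
  · obtain ⟨v⟩ := hG.nonempty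
    refine ⟨⟨0, electsLeaderBy_leaderElection_zero G ids v, ?_⟩, fun t => ?_⟩
    · rw [Nat.cast_zero]
      positivity
    · rw [messageCount_eq_zero_of_subsingleton, Nat.cast_zero]
      positivity
  · obtain ⟨⟨T, hT, helects⟩, hmessages⟩ := leaderElection_of_nontrivial ids hG
    refine ⟨⟨T, helects, ?_⟩, fun t => ?_⟩
    · refine (cast_le_of_le_mul_natLog_sq hT).trans_eq ?_
      push_cast
      ring
    · refine (cast_le_of_le_mul_natLog_sq (hmessages t)).trans_eq ?_
      push_cast
      ring
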